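/- Let $H:[0,\infty)\to[0,1]$ be Borel measurable with $\|H\|_1=\int_0^\infty H(r)\,dr<\infty$, and let $\gamma>0$. For $L>1$ put $R_L=\gamma\ln L$ and consider the soft random geometric graph on the circle of length $L$, that is, the interval $[0,L]$ with its endpoints identified, with circular distance $\rho$: the nodes are the points of a Poisson point process of unit intensity on the circle and, given the nodes, each pair of distinct nodes $x,y$ is joined by an edge with probability $h^L(x,y)=H(\rho(x,y)/R_L)$, independently of all other pairs. A node is isolated if it is joined to no other node; let $N_{\mathrm{iso}}$ be the number of isolated nodes. Then $$\lim_{L\to\infty}\mathbb P(N_{\mathrm{iso}}=0)=\begin{cases}0,&\text{if }2\gamma\|H\|_1<1,\\ 1,&\text{if }2\gamma\|H\|_1>1.\end{cases}$$ Moreover, the mean degree $d_L$ of the graph (the expected sum of the degrees of all nodes, divided by the expected number of nodes) equals $\int_0^L h^L(0,z)\,dz$ for every $L>1$, and $d_L/\ln L\to 2\gamma\|H\|_1$ as $L\to\infty$; thus the threshold is at mean degree $\ln L$. -/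

import Mathlib

open MeasureTheory ProbabilityTheory Filter Topology
open scoped NNReal ENNReal

/-- The number of points of the finite configuration `V` that lie in `B`. -/
noncomputable def pointCount {E : Type*} (V : Finset E) (B : Set E) : ℕ :=
  ((V : Set E) ∩ B).ncard

/-- The random finite set `V` is a Poisson point process with (finite) intensity measure `ν`:
the number of points in a Borel set `B` is a Poisson random variable with mean `ν B`, and
the numbers of points in pairwise disjoint sets are mutually independent. -/
structure IsPoissonProcess {Ω E : Type*} [MeasurableSpace Ω] [MeasurableSpace E]
    (P : Measure Ω) (ν : Measure E) [IsFiniteMeasure ν] (V : Ω → Finset E) : Prop where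
  measurable_count : ∀ B : Set E, MeasurableSet B → Measurable fun ω => pointCount (V ω) B
  law_count : ∀ B : Set E, MeasurableSet B →
    HasLaw (fun ω => pointCount (V ω) B) (poissonMeasure (ν B).toNNReal) P
  indep_count : ∀ (k : ℕ) (B : Fin k → Set E), (∀ i, MeasurableSet (B i)) →
    Pairwise (fun i j => Disjoint (B i) (B j)) →
    iIndepFun (fun i ω => pointCount (V ω) (B i)) P

open Classical in
/-- The probability of the labelled graph `g` on points `x 0, …, x (n - 1)` when the pairs of points
are joined independently, the pair `x i`, `x j` with probability `h (x i) (x j)`. -/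
noncomputable def graphProb {E : Type*} (h : E → E → ℝ) {n : ℕ} (x : Fin n → E)
    (g : SimpleGraph (Fin n)) : ℝ :=
  ∏ p : Fin n × Fin n with p.1 < p.2,
    if g.Adj p.1 p.2 then h (x p.1) (x p.2) else 1 - h (x p.1) (x p.2)

/-- The points of `V` are enumerated without repetition as `X 0, X 1, …, X (#V - 1)`, measurably,
and, conditionally on the enumerated configuration, distinct points `x`, `y` of `V` are joined in `G`
with probability `h x y`, independently for different pairs.  The conditional law of the graph is
expressed by integrating over arbitrary events of the configuration.  Only the edges of `G` between
points of `V` play a role. -/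
structure HasIndependentEdges {Ω E : Type*} [MeasurableSpace Ω] [MeasurableSpace E]
    (P : Measure Ω) (h : E → E → ℝ) (V : Ω → Finset E) (G : Ω → SimpleGraph E)
    (X : ℕ → Ω → E) : Prop where
  measurable_enum : ∀ i, Measurable (X i)
  bijOn_enum : ∀ ω, Set.BijOn (fun i => X i ω) (Set.Iio (V ω).card) (V ω : Set E)
  measurableSet_graph : ∀ (n : ℕ) (g : SimpleGraph (Fin n)), MeasurableSet
    {ω | (V ω).card = n ∧ ∀ i j : Fin n, (G ω).Adj (X i ω) (X j ω) ↔ g.Adj i j}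
  law_graph : ∀ (n : ℕ) (g : SimpleGraph (Fin n)) (S : Set (Fin n → E)), MeasurableSet S →
    P ({ω | (V ω).card = n ∧ (fun i : Fin n => X i ω) ∈ S} ∩
        {ω | (V ω).card = n ∧ ∀ i j : Fin n, (G ω).Adj (X i ω) (X j ω) ↔ g.Adj i j}) =
      ∫⁻ ω in {ω | (V ω).card = n ∧ (fun i : Fin n => X i ω) ∈ S},
        ENNReal.ofReal (graphProb h (fun i : Fin n => X i ω) g) ∂P

/-- A soft random geometric graph on the circle `ℝ / Lℤ` of length `L`: the node set `V` is a Poisson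
process of unit intensity, and, given the nodes, pairs of nodes `x`, `y` are joined
independently with probability `h x y`. -/
structure IsSoftRGG {Ω : Type*} [MeasurableSpace Ω] (P : Measure Ω) (L : ℝ) [Fact (0 < L)]
    (h : AddCircle L → AddCircle L → ℝ) (V : Ω → Finset (AddCircle L))
    (G : Ω → SimpleGraph (AddCircle L)) : Prop where
  poisson : IsPoissonProcess P (volume : Measure (AddCircle L)) V
  edges : ∃ X : ℕ → Ω → AddCircle L, HasIndependentEdges P h V G X

/-- The connection probability `H (ρ(x, y) / R)`, where `ρ(x, y) = ‖x - y‖` is the circular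
distance on the circle of length `L`. -/
noncomputable def scaledConnection (H : ℝ → ℝ) (R L : ℝ) (x y : AddCircle L) : ℝ :=
  H (‖x - y‖ / R)

/-- The number of isolated nodes: points of `V` not joined by an edge to any other point of `V`. -/
noncomputable def numIsolated {E : Type*} (V : Finset E) (G : SimpleGraph E) : ℕ :=
  {x : E | x ∈ V ∧ ∀ y ∈ V, y ≠ x → ¬ G.Adj x y}.ncard

/-- The mean degree: the expected sum of the degrees of all nodes divided by the expected number of
nodes. -/
noncomputable def meanDegree {Ω E : Type*} [MeasurableSpace Ω] (P : Measure Ω)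
    (V : Ω → Finset E) (G : Ω → SimpleGraph E) : ℝ≥0∞ :=
  (∫⁻ ω, ((∑ x ∈ V ω, {y : E | y ∈ V ω ∧ (G ω).Adj x y}.ncard : ℕ) : ℝ≥0∞) ∂P) /
    ∫⁻ ω, ((V ω).card : ℝ≥0∞) ∂P

/-!
Given their number `n`, the enumerated points of a Poisson process of intensity `ν` are, after
symmetrization, distributed as `n` independent points with law proportional to `ν`. Therefore the
expectation of a sum over `k`-tuples of distinct points is an integral against `ν^k` of the
expectation for the configuration with these `k` points added (the multivariate Mecke formula).

On the circle the connection probabilities of a point `x` have the same integral `d` for every `x`.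
A point added to the process is isolated with probability `exp (-d)`, so the number `N` of isolated
nodes has mean `M = L * exp (-d)`. Two points `x`, `y` are both isolated with probability
at most `exp (c - 2 * d)`, where `c = ∫ h x z * h y z ≤ d`. Since `exp c ≤ 1 + c * exp d` and `c`
integrates to `d ^ 2` over `y`, this gives `Var N ≤ (1 + d ^ 2) * M`. As `d / log L` tends to
`κ = 2 * γ * ‖H‖₁`, the mean `M` is `L ^ (1 - κ + o(1))`: Markov's inequality handles `κ > 1`, and
Chebyshev's inequality `κ < 1`.
-/

section FiniteConfigurations

variable {E : Type*}

theorem pointCount_univ (V : Finset E) : pointCount V Set.univ = V.card := by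
  simp [pointCount]

theorem pointCount_eq_zero_iff {V : Finset E} {B : Set E} :
    pointCount V B = 0 ↔ ∀ x ∈ V, x ∉ B := by
  rw [pointCount, Set.ncard_eq_zero (V.finite_toSet.inter_of_left B),
    ← Set.disjoint_iff_inter_eq_empty, Set.disjoint_left]
  rfl

theorem pointCount_eq_one_iff {V : Finset E} {B : Set E} :
    pointCount V B = 1 ↔ ∃ x, (x ∈ V ∧ x ∈ B) ∧ ∀ y ∈ V, y ∈ B → y = x := by
  simp only [pointCount, Set.ncard_eq_one, Set.eq_singleton_iff_unique_mem, Set.mem_inter_iff,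
    SetLike.mem_coe, and_imp]

theorem one_point_in_each_iff {ι : Type*} [Fintype ι] {V : Finset E} {B : ι → Set E}
    (hB : Pairwise fun i j => Disjoint (B i) (B j)) :
    (pointCount V (⋃ i, B i)ᶜ = 0 ∧ ∀ i, pointCount V (B i) = 1) ↔
      ∃ x : ι ↪ E, V = Finset.univ.map x ∧ ∀ i, x i ∈ B i := by
  simp only [pointCount_eq_zero_iff, pointCount_eq_one_iff, Set.notMem_compl_iff, Set.mem_iUnion]
  constructor
  · rintro ⟨hcover, hone⟩
    choose x hx hunique using hone
    have hinj : Function.Injective x := fun i j hij => by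
      by_contra hne
      exact Set.disjoint_left.1 (hB hne) (hx i).2 (hij ▸ (hx j).2)
    refine ⟨⟨x, hinj⟩, Finset.ext fun y => ?_, fun i => (hx i).2⟩
    simp only [Finset.mem_map, Finset.mem_univ, true_and, Function.Embedding.coeFn_mk]
    refine ⟨fun hy => ?_, fun ⟨i, hi⟩ => hi ▸ (hx i).1⟩
    obtain ⟨i, hi⟩ := hcover y hy
    exact ⟨i, (hunique i y hy hi).symm⟩
  · rintro ⟨x, rfl, hx⟩
    simp only [Finset.mem_map, Finset.mem_univ, true_and, forall_exists_index,
      forall_apply_eq_imp_iff]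
    refine ⟨fun i => ⟨i, hx i⟩, fun i => ⟨x i, ⟨⟨i, rfl⟩, hx i⟩, fun j hj => ?_⟩⟩
    by_contra hne
    exact Set.disjoint_left.1 (hB (ne_of_apply_ne x hne)) (hx j) hj

theorem exists_embedding_of_bijOn {V : Finset E} {x : ℕ → E}
    (hx : Set.BijOn x (Set.Iio V.card) V) {n : ℕ} (hn : V.card = n) :
    ∃ f : Fin n ↪ E, (∀ i : Fin n, f i = x i) ∧ V = Finset.univ.map f := by
  subst hn
  have hinj : Function.Injective fun i : Fin V.card => x i :=
    fun i j hij => Fin.ext (hx.injOn i.2 j.2 hij)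
  refine ⟨⟨_, hinj⟩, fun i => rfl,
    Finset.ext fun y => (Set.ext_iff.1 hx.image_eq y).symm.trans ?_⟩
  simp [Fin.exists_iff]

theorem exists_perm_of_map_univ_eq {ι : Type*} [Fintype ι] {f g : ι ↪ E}
    (h : Finset.univ.map f = Finset.univ.map g) :
    ∃ σ : Equiv.Perm ι, ∀ i, g i = f (σ i) := by
  have hmem : ∀ i, ∃ j, f j = g i := fun i => by
    have hi : g i ∈ Finset.univ.map f := h ▸ Finset.mem_map_of_mem g (Finset.mem_univ i)
    simpa using hi
  choose τ hτ using hmem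
  have hinj : Function.Injective τ := fun i j hij => g.injective (by rw [← hτ i, ← hτ j, hij])
  exact ⟨Equiv.ofBijective τ (Finite.injective_iff_bijective.1 hinj), fun i => (hτ i).symm⟩

theorem one_point_in_each_iff_exists_perm {V : Finset E} {x : ℕ → E}
    (hx : Set.BijOn x (Set.Iio V.card) V) {n : ℕ} {B : Fin n → Set E}
    (hB : Pairwise fun i j => Disjoint (B i) (B j)) :
    (pointCount V (⋃ i, B i)ᶜ = 0 ∧ ∀ i, pointCount V (B i) = 1) ↔
      ∃ σ : Equiv.Perm (Fin n), V.card = n ∧ ∀ i, x (σ i) ∈ B i := by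
  rw [one_point_in_each_iff hB]
  constructor
  · rintro ⟨y, hV, hy⟩
    have hn : V.card = n := by simp [hV]
    obtain ⟨f, hf, hVf⟩ := exists_embedding_of_bijOn hx hn
    obtain ⟨σ, hσ⟩ := exists_perm_of_map_univ_eq (hVf.symm.trans hV)
    exact ⟨σ, hn, fun i => by simpa [hσ, hf] using hy i⟩
  · rintro ⟨σ, hn, hσ⟩
    obtain ⟨f, hf, hVf⟩ := exists_embedding_of_bijOn hx hn
    refine ⟨σ.toEmbedding.trans f, ?_, fun i => by simpa [hf] using hσ i⟩
    rw [← Finset.map_map, Finset.map_univ_equiv, hVf]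

end FiniteConfigurations

section DistinctTuples

variable {E : Type*} [TopologicalSpace E] [T2Space E] [SecondCountableTopology E]

theorem exists_countable_boxes_eq_setOf_injective (ι : Type*) [Finite ι] :
    ∃ 𝓑 : Set (ι → Set E), 𝓑.Countable ∧ (∀ B ∈ 𝓑, ∀ i, IsOpen (B i)) ∧
      (∀ B ∈ 𝓑, Pairwise fun i j => Disjoint (B i) (B j)) ∧
      {x : ι → E | Function.Injective x} = ⋃ B ∈ 𝓑, Set.univ.pi B := by
  let b := TopologicalSpace.countableBasis E
  have hb := TopologicalSpace.isBasis_countableBasis E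
  refine ⟨{B | (∀ i, B i ∈ b) ∧ Pairwise fun i j => Disjoint (B i) (B j)},
    (Set.countable_pi fun _ => TopologicalSpace.countable_countableBasis E).mono
      fun B hB i => hB.1 i,
    fun B hB i => hb.isOpen (hB.1 i), fun B hB => hB.2, Set.Subset.antisymm ?_ ?_⟩
  · intro x (hx : Function.Injective x)
    obtain ⟨U, hU, hUd⟩ := (Set.finite_range x).t2_separation
    choose B hBb hxB hBU using fun i => hb.exists_subset_of_mem_open (hU (x i)).1 (hU (x i)).2
    exact Set.mem_biUnion
      ⟨hBb, fun i j hij => (hUd ⟨i, rfl⟩ ⟨j, rfl⟩ (hx.ne hij)).mono (hBU i) (hBU j)⟩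
      fun i _ => hxB i
  · refine Set.iUnion₂_subset fun B hB x hx i j hij => ?_
    by_contra hne
    exact Set.disjoint_left.1 (hB.2 hne) (hx i trivial) (hij ▸ hx j trivial)

variable [MeasurableSpace E] [BorelSpace E] {ι : Type*} [Finite ι]

theorem measurableSet_setOf_injective : MeasurableSet {x : ι → E | Function.Injective x} := by
  obtain ⟨𝓑, hc, ho, -, h⟩ := exists_countable_boxes_eq_setOf_injective (E := E) ι
  rw [h]
  exact .biUnion hc fun B hB => .univ_pi fun i => (ho B hB i).measurableSet

theorem restrict_setOf_injective_congr {μ₁ μ₂ : Measure (ι → E)} [IsFiniteMeasure μ₁]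
    (h : ∀ B : ι → Set E, (∀ i, MeasurableSet (B i)) →
      (Pairwise fun i j => Disjoint (B i) (B j)) → μ₁ (Set.univ.pi B) = μ₂ (Set.univ.pi B)) :
    μ₁.restrict {x | Function.Injective x} = μ₂.restrict {x | Function.Injective x} := by
  obtain ⟨𝓑, hc, ho, hd, hcover⟩ := exists_countable_boxes_eq_setOf_injective (E := E) ι
  rw [hcover, Measure.restrict_biUnion_congr hc]
  intro B hB
  have hgen : ∀ D : ι → Set E, (∀ i, MeasurableSet (D i)) →
      μ₁.restrict (Set.univ.pi B) (Set.univ.pi D) =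
        μ₂.restrict (Set.univ.pi B) (Set.univ.pi D) := fun D hD => by
    rw [Measure.restrict_apply (.univ_pi hD), Measure.restrict_apply (.univ_pi hD),
      ← Set.pi_inter_distrib]
    exact h _ (fun i => (hD i).inter (ho B hB i).measurableSet)
      fun i j hij => (hd B hB hij).mono Set.inter_subset_right Set.inter_subset_right
  refine ext_of_generate_finite _ generateFrom_pi.symm isPiSystem_pi ?_ ?_
  · rintro _ ⟨D, hD, rfl⟩
    exact hgen D fun i => hD i (Set.mem_univ i)
  · simpa using hgen (fun _ => Set.univ) fun _ => .univ

theorem measure_ext_of_disjoint_boxes {μ₁ μ₂ : Measure (ι → E)} [IsFiniteMeasure μ₁]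
    (h : ∀ B : ι → Set E, (∀ i, MeasurableSet (B i)) →
      (Pairwise fun i j => Disjoint (B i) (B j)) → μ₁ (Set.univ.pi B) = μ₂ (Set.univ.pi B))
    (huniv : μ₁ Set.univ = μ₂ Set.univ) (hnull : ∀ᵐ x ∂μ₁, Function.Injective x) : μ₁ = μ₂ := by
  set S := {x : ι → E | Function.Injective x}
  have hS : MeasurableSet S := measurableSet_setOf_injective
  have hres : μ₁.restrict S = μ₂.restrict S := restrict_setOf_injective_congr h
  have hfin : IsFiniteMeasure μ₂ := ⟨huniv ▸ measure_lt_top μ₁ _⟩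
  have hnull₂ : μ₂ Sᶜ = 0 := by
    rw [measure_compl hS (measure_ne_top _ _), ← huniv, ← Measure.restrict_apply_univ S, ← hres,
      Measure.restrict_apply_univ, ← measure_compl hS (measure_ne_top _ _)]
    exact hnull
  rw [← Measure.restrict_eq_self_of_ae_mem (s := S) hnull, hres,
    Measure.restrict_eq_self_of_ae_mem (s := S) hnull₂]

end DistinctTuples

section PoissonProcess

variable {Ω E : Type*} [MeasurableSpace Ω] [MeasurableSpace E]
  {P : Measure Ω} {ν : Measure E} [IsFiniteMeasure ν] {V : Ω → Finset E} {X : ℕ → Ω → E}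

theorem IsPoissonProcess.measurableSet_card_eq (hV : IsPoissonProcess P ν V) (n : ℕ) :
    MeasurableSet {ω | (V ω).card = n} := by
  simpa only [Set.preimage, pointCount_univ, Set.mem_singleton_iff] using
    hV.measurable_count Set.univ .univ (measurableSet_singleton n)

theorem IsPoissonProcess.measure_count_eq (hV : IsPoissonProcess P ν V) {B : Set E}
    (hB : MeasurableSet B) (n : ℕ) :
    P {ω | pointCount (V ω) B = n} =
      ENNReal.ofReal (Real.exp (-ν.real B)) / n.factorial * ν B ^ n := by
  have hlaw := (hV.law_count B hB).measure_eq (p := fun k => k = n) (measurableSet_singleton n)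
  simp only [Set.ofPred_eq_eq_singleton, poissonMeasure_singleton] at hlaw
  have hpow : ν B ^ n = ENNReal.ofReal (ν.real B ^ n) := by
    rw [ENNReal.ofReal_pow measureReal_nonneg, ofReal_measureReal]
  rw [hlaw, hpow, ← ENNReal.ofReal_natCast, ← ENNReal.ofReal_div_of_pos (by positivity),
    ← ENNReal.ofReal_mul (by positivity), div_mul_eq_mul_div]
  rfl

theorem IsPoissonProcess.measure_card_eq (hV : IsPoissonProcess P ν V) (n : ℕ) :
    P {ω | (V ω).card = n} =
      ENNReal.ofReal (Real.exp (-ν.real Set.univ)) / n.factorial * ν Set.univ ^ n := by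
  simpa only [pointCount_univ] using hV.measure_count_eq .univ n

theorem IsPoissonProcess.measure_one_point_in_each (hV : IsPoissonProcess P ν V) {n : ℕ}
    {B : Fin n → Set E} (hBm : ∀ i, MeasurableSet (B i))
    (hB : Pairwise fun i j => Disjoint (B i) (B j)) :
    P {ω | pointCount (V ω) (⋃ i, B i)ᶜ = 0 ∧ ∀ i, pointCount (V ω) (B i) = 1} =
      ENNReal.ofReal (Real.exp (-ν.real Set.univ)) * ∏ i, ν (B i) := by
  have hU : MeasurableSet (⋃ i, B i) := .iUnion hBm
  let C : Fin (n + 1) → Set E := Fin.cons (⋃ i, B i)ᶜ B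
  let k : Fin (n + 1) → ℕ := Fin.cons 0 fun _ => 1
  have hCm : ∀ i, MeasurableSet (C i) := Fin.cases hU.compl hBm
  have hC : Pairwise fun i j => Disjoint (C i) (C j) := by
    have hcompl : ∀ i, Disjoint (⋃ i, B i)ᶜ (B i) := fun i =>
      Set.disjoint_compl_left_iff_subset.2 (Set.subset_iUnion B i)
    refine Fin.cases (Fin.cases (fun h => (h rfl).elim) fun j _ => hcompl j) fun i => ?_
    exact Fin.cases (fun _ => (hcompl i).symm) fun j h => hB (ne_of_apply_ne Fin.succ h)
  have hevent : {ω | pointCount (V ω) (⋃ i, B i)ᶜ = 0 ∧ ∀ i, pointCount (V ω) (B i) = 1} =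
      ⋂ i ∈ Finset.univ, (fun ω => pointCount (V ω) (C i)) ⁻¹' {k i} := by
    ext ω
    simp [Fin.forall_fin_succ, C, k]
  calc
    _ = ∏ i, P {ω | pointCount (V ω) (C i) = k i} := by
      rw [hevent]
      exact (hV.indep_count (n + 1) C hCm hC).measure_inter_preimage_eq_mul Finset.univ
        fun i _ => measurableSet_singleton (k i)
    _ = ENNReal.ofReal (Real.exp (-ν.real (⋃ i, B i)ᶜ)) *
        ∏ i, ENNReal.ofReal (Real.exp (-ν.real (B i))) * ν (B i) := by
      simp only [hV.measure_count_eq (hCm _)]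
      simp [Fin.prod_univ_succ, C, k]
    _ = _ := by
      rw [Finset.prod_mul_distrib, ← mul_assoc,
        ← ENNReal.ofReal_prod_of_nonneg fun i _ => by positivity,
        ← ENNReal.ofReal_mul (by positivity), ← Real.exp_sum, ← Real.exp_add,
        Finset.sum_neg_distrib, ← neg_add, ← measureReal_iUnion_fintype hB hBm, add_comm,
        measureReal_add_measureReal_compl hU]

/-- The `n`-th Janossy measure of the point process `V` with measurable enumeration `X`: the law of
the points on the event that there are `n` of them, summed over all orderings.  It does not depend
on the enumeration. -/
noncomputable def janossyMeasure (P : Measure Ω) (V : Ω → Finset E) (X : ℕ → Ω → E) (n : ℕ) :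
    Measure (Fin n → E) :=
  ∑ σ : Equiv.Perm (Fin n), (P.restrict {ω | (V ω).card = n}).map fun ω i => X (σ i) ω

theorem janossyMeasure_apply (hX : ∀ i, Measurable (X i)) {n : ℕ} {S : Set (Fin n → E)}
    (hS : MeasurableSet S) :
    janossyMeasure P V X n S =
      ∑ σ : Equiv.Perm (Fin n), P {ω | (V ω).card = n ∧ (fun i => X (σ i) ω) ∈ S} := by
  rw [janossyMeasure, Measure.finsetSum_apply]
  refine Finset.sum_congr rfl fun σ _ => ?_
  have hXσ : Measurable fun ω i => X (σ i) ω := measurable_pi_lambda _ fun i => hX _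
  rw [Measure.map_apply hXσ hS, Measure.restrict_apply (hXσ hS), Set.inter_comm]
  rfl

theorem IsPoissonProcess.janossyMeasure_univ (hV : IsPoissonProcess P ν V)
    (hX : ∀ i, Measurable (X i)) (n : ℕ) :
    janossyMeasure P V X n Set.univ =
      ENNReal.ofReal (Real.exp (-ν.real Set.univ)) * ν Set.univ ^ n := by
  have hfact : (n.factorial : ℝ≥0∞) ≠ 0 := by simp [n.factorial_ne_zero]
  simp only [janossyMeasure_apply hX .univ, Set.mem_univ, and_true, hV.measure_card_eq,
    Finset.sum_const, Finset.card_univ, Fintype.card_perm, Fintype.card_fin, nsmul_eq_mul]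
  rw [← mul_assoc, ENNReal.mul_div_cancel hfact (ENNReal.natCast_ne_top _)]

theorem IsPoissonProcess.janossyMeasure_pi (hV : IsPoissonProcess P ν V)
    (hX : ∀ i, Measurable (X i))
    (hXV : ∀ ω, Set.BijOn (fun i => X i ω) (Set.Iio (V ω).card) (V ω)) {n : ℕ}
    {B : Fin n → Set E} (hBm : ∀ i, MeasurableSet (B i))
    (hB : Pairwise fun i j => Disjoint (B i) (B j)) :
    janossyMeasure P V X n (Set.univ.pi B) =
      ENNReal.ofReal (Real.exp (-ν.real Set.univ)) * ∏ i, ν (B i) := by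
  rw [janossyMeasure_apply hX (.univ_pi hBm), ← hV.measure_one_point_in_each hBm hB]
  simp only [one_point_in_each_iff_exists_perm (hXV _) hB, Set.mem_univ_pi]
  rw [Set.ofPred_exists, measure_iUnion, tsum_fintype]
  · intro σ τ hστ
    refine Set.disjoint_left.2 fun ω ⟨_, hσ⟩ ⟨_, hτ⟩ => hστ (Equiv.ext fun i => ?_)
    obtain ⟨j, hj⟩ := τ.surjective (σ i)
    have hij : i = j := by
      by_contra hne
      exact Set.disjoint_left.1 (hB hne) (hσ i) (hj ▸ hτ j)
    rw [← hj, hij]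
  · have hBσ : ∀ σ : Equiv.Perm (Fin n), MeasurableSet {ω | ∀ i, X (σ i) ω ∈ B i} := fun σ => by
      rw [Set.ofPred_forall]
      exact .iInter fun i => hX _ (hBm i)
    exact fun σ => (hV.measurableSet_card_eq n).inter (hBσ σ)

variable [TopologicalSpace E] [T2Space E] [SecondCountableTopology E] [BorelSpace E]

theorem ae_janossyMeasure_injective (hX : ∀ i, Measurable (X i))
    (hXV : ∀ ω, Set.BijOn (fun i => X i ω) (Set.Iio (V ω).card) (V ω)) (n : ℕ) :
    ∀ᵐ x ∂janossyMeasure P V X n, Function.Injective x := by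
  refine (janossyMeasure_apply hX measurableSet_setOf_injective.compl).trans
    (Finset.sum_eq_zero fun σ _ => ?_)
  convert measure_empty (μ := P)
  refine Set.eq_empty_of_forall_notMem fun ω ⟨hn, hinj⟩ => hinj ?_
  obtain ⟨f, hf, -⟩ := exists_embedding_of_bijOn (hXV ω) hn
  simp only [← hf]
  exact f.injective.comp σ.injective

theorem IsPoissonProcess.janossyMeasure_eq (hV : IsPoissonProcess P ν V)
    (hX : ∀ i, Measurable (X i))
    (hXV : ∀ ω, Set.BijOn (fun i => X i ω) (Set.Iio (V ω).card) (V ω)) (n : ℕ) :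
    janossyMeasure P V X n =
      ENNReal.ofReal (Real.exp (-ν.real Set.univ)) • Measure.pi fun _ => ν := by
  have huniv := hV.janossyMeasure_univ hX n
  have : IsFiniteMeasure (janossyMeasure P V X n) :=
    ⟨huniv ▸ ENNReal.mul_lt_top ENNReal.ofReal_lt_top (ENNReal.pow_lt_top (measure_lt_top ν _))⟩
  refine measure_ext_of_disjoint_boxes (fun B hBm hB => ?_) ?_
    (ae_janossyMeasure_injective hX hXV n)
  · simp [hV.janossyMeasure_pi hX hXV hBm hB]
  · simp [huniv, Measure.pi_univ]

theorem IsPoissonProcess.setLIntegral_card_eq (hV : IsPoissonProcess P ν V)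
    (hX : ∀ i, Measurable (X i))
    (hXV : ∀ ω, Set.BijOn (fun i => X i ω) (Set.Iio (V ω).card) (V ω)) {n : ℕ}
    {f : (Fin n → E) → ℝ≥0∞} (hf : Measurable f)
    (hf_perm : ∀ (σ : Equiv.Perm (Fin n)) x, f (x ∘ σ) = f x) :
    ∫⁻ ω in {ω | (V ω).card = n}, f (fun i => X i ω) ∂P =
      ENNReal.ofReal (Real.exp (-ν.real Set.univ)) / n.factorial *
        ∫⁻ x, f x ∂Measure.pi fun _ => ν := by
  have hfact : (n.factorial : ℝ≥0∞) ≠ 0 := by simp [n.factorial_ne_zero]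
  have hperm : ∀ σ : Equiv.Perm (Fin n), ∫⁻ x, f x ∂(P.restrict {ω | (V ω).card = n}).map
      (fun ω i => X (σ i) ω) = ∫⁻ ω in {ω | (V ω).card = n}, f (fun i => X i ω) ∂P := fun σ => by
    rw [lintegral_map hf (measurable_pi_lambda _ fun i => hX _)]
    exact lintegral_congr fun ω => hf_perm σ fun i => X i ω
  have hsum : n.factorial * ∫⁻ ω in {ω | (V ω).card = n}, f (fun i => X i ω) ∂P =
      ENNReal.ofReal (Real.exp (-ν.real Set.univ)) * ∫⁻ x, f x ∂Measure.pi fun _ => ν := by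
    rw [← smul_eq_mul (ENNReal.ofReal _), ← lintegral_smul_measure,
      ← hV.janossyMeasure_eq hX hXV, janossyMeasure, lintegral_finsetSum_measure]
    simp only [hperm, Finset.sum_const, Finset.card_univ, Fintype.card_perm, Fintype.card_fin,
      nsmul_eq_mul]
  rw [← ENNReal.mul_div_right_comm, ← hsum, mul_comm (n.factorial : ℝ≥0∞),
    ENNReal.mul_div_cancel_right hfact (ENNReal.natCast_ne_top _)]

end PoissonProcess

section PoissonExpectation

variable {E : Type*} [MeasurableSpace E] {ν : Measure E}

/-- The expected value of `f n (x 0, …, x (n - 1))`, where `x 0, …, x (n - 1)` are the points, in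
any order, of a Poisson process with intensity `ν`. -/
noncomputable def poissonExpectation (ν : Measure E) (f : ∀ n, (Fin n → E) → ℝ≥0∞) : ℝ≥0∞ :=
  ∑' n, ENNReal.ofReal (Real.exp (-ν.real Set.univ)) / n.factorial *
    ∫⁻ x, f n x ∂Measure.pi fun _ => ν

/-- The sum of `g a` over the points `a` of a configuration, where `g a` is evaluated at the
configuration of the remaining points. -/
noncomputable def pointSum (g : E → ∀ n, (Fin n → E) → ℝ≥0∞) : ∀ n, (Fin n → E) → ℝ≥0∞
  | 0, _ => 0
  | n + 1, x => ∑ i : Fin (n + 1), g (x i) n (i.removeNth x)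

theorem poissonExpectation_add {f g : ∀ n, (Fin n → E) → ℝ≥0∞} (hf : ∀ n, Measurable (f n)) :
    poissonExpectation ν (fun n x => f n x + g n x) =
      poissonExpectation ν f + poissonExpectation ν g := by
  simp only [poissonExpectation, lintegral_add_left (hf _), mul_add, ENNReal.tsum_add]

theorem poissonExpectation_const_mul {c : ℝ≥0∞} (hc : c ≠ ⊤) (f : ∀ n, (Fin n → E) → ℝ≥0∞) :
    poissonExpectation ν (fun n x => c * f n x) = c * poissonExpectation ν f := by
  simp only [poissonExpectation, lintegral_const_mul' c _ hc, mul_left_comm _ c,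
    ENNReal.tsum_mul_left]

variable [IsFiniteMeasure ν]

theorem measurable_removeNth {n : ℕ} (i : Fin (n + 1)) :
    Measurable fun x : Fin (n + 1) → E => i.removeNth x :=
  measurable_pi_lambda _ fun k => measurable_pi_apply (i.succAbove k)

theorem measurable_pointSum {α : Type*} [MeasurableSpace α]
    {g : α → E → ∀ n, (Fin n → E) → ℝ≥0∞}
    (hg : ∀ n, Measurable fun p : (α × E) × (Fin n → E) => g p.1.1 p.1.2 n p.2) :
    ∀ n, Measurable fun p : α × (Fin n → E) => pointSum (g p.1) n p.2
  | 0 => measurable_const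
  | n + 1 => by
    have hsplit : ∀ i : Fin (n + 1), Measurable fun p : α × (Fin (n + 1) → E) =>
        ((p.1, p.2 i), i.removeNth p.2) := fun i =>
      (measurable_fst.prodMk (measurable_pi_apply i |>.comp measurable_snd)).prodMk
        ((measurable_removeNth i).comp measurable_snd)
    exact Finset.measurable_fun_sum _ fun i _ => (hg n).comp (hsplit i)

theorem lintegral_pi_insertNth {n : ℕ} (i : Fin (n + 1)) {f : (Fin (n + 1) → E) → ℝ≥0∞}
    (hf : Measurable f) :
    ∫⁻ x, f x ∂Measure.pi (fun _ => ν) =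
      ∫⁻ a, ∫⁻ y, f (i.insertNth a y) ∂Measure.pi (fun _ => ν) ∂ν := by
  have h := (measurePreserving_piFinSuccAbove (fun _ : Fin (n + 1) => ν) i).symm
  rw [← h.lintegral_comp_emb (MeasurableEquiv.measurableEmbedding _), lintegral_prod]
  · rfl
  · exact (hf.comp (MeasurableEquiv.measurable _)).aemeasurable

theorem lintegral_pi_prod {u : E → ℝ≥0∞} (hu : Measurable u) (n : ℕ) :
    ∫⁻ x, ∏ k, u (x k) ∂Measure.pi (fun _ : Fin n => ν) = (∫⁻ a, u a ∂ν) ^ n := by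
  have hm : ∀ n : ℕ, Measurable fun x : Fin n → E => ∏ k, u (x k) := fun n =>
    Finset.measurable_fun_prod _ fun k _ => hu.comp (measurable_pi_apply k)
  induction n with
  | zero => simp
  | succ n ih =>
    rw [lintegral_pi_insertNth 0 (hm _)]
    simp only [Fin.prod_univ_succAbove _ (0 : Fin (n + 1)), Fin.insertNth_apply_same,
      Fin.insertNth_apply_succAbove, lintegral_const_mul _ (hm n), ih, lintegral_mul_const _ hu,
      pow_succ']

theorem lintegral_pi_pointSum {g : E → ∀ n, (Fin n → E) → ℝ≥0∞}
    (hg : ∀ n, Measurable fun p : E × (Fin n → E) => g p.1 n p.2) (n : ℕ) :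
    ∫⁻ x, pointSum g (n + 1) x ∂Measure.pi (fun _ => ν) =
      (n + 1 : ℕ) * ∫⁻ a, ∫⁻ y, g a n y ∂Measure.pi (fun _ => ν) ∂ν := by
  have hm : ∀ i : Fin (n + 1), Measurable fun x : Fin (n + 1) → E => g (x i) n (i.removeNth x) :=
    fun i => (hg n).comp ((measurable_pi_apply i).prodMk (measurable_removeNth i))
  have hterm : ∀ i : Fin (n + 1),
      ∫⁻ x, g (x i) n (i.removeNth x) ∂Measure.pi (fun _ => ν) =
        ∫⁻ a, ∫⁻ y, g a n y ∂Measure.pi (fun _ => ν) ∂ν := fun i => by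
    rw [lintegral_pi_insertNth i (hm i)]
    simp only [Fin.insertNth_apply_same, Fin.removeNth_insertNth]
  simp only [pointSum]
  rw [lintegral_finsetSum _ fun i _ => hm i]
  simp only [hterm, Finset.sum_const, Finset.card_univ, Fintype.card_fin, nsmul_eq_mul]

theorem div_factorial_succ_mul_succ (c : ℝ≥0∞) (n : ℕ) :
    c / (n + 1).factorial * (n + 1 : ℕ) = c / n.factorial := by
  have h0 : ((n + 1 : ℕ) : ℝ≥0∞) ≠ 0 := by exact_mod_cast n.succ_ne_zero
  rw [Nat.factorial_succ, Nat.cast_mul, ← ENNReal.mul_div_right_comm,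
    mul_comm, ENNReal.mul_div_mul_left _ _ h0 (ENNReal.natCast_ne_top _)]

theorem poissonExpectation_pointSum {g : E → ∀ n, (Fin n → E) → ℝ≥0∞}
    (hg : ∀ n, Measurable fun p : E × (Fin n → E) => g p.1 n p.2) :
    poissonExpectation ν (pointSum g) = ∫⁻ a, poissonExpectation ν (g a) ∂ν := by
  have hm : ∀ n, Measurable fun a => ∫⁻ y, g a n y ∂Measure.pi fun _ => ν := fun n =>
    (hg n).lintegral_prod_right'
  simp only [poissonExpectation]
  rw [lintegral_tsum fun n => ((hm n).const_mul _).aemeasurable,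
    tsum_eq_zero_add' ENNReal.summable]
  simp only [lintegral_pi_pointSum hg, ← mul_assoc, div_factorial_succ_mul_succ,
    lintegral_const_mul _ (hm _)]
  simp [pointSum]

theorem tsum_div_factorial_mul_pow (c : ℝ) {t : ℝ} (ht : 0 ≤ t) :
    ∑' n : ℕ, ENNReal.ofReal (Real.exp c) / n.factorial * ENNReal.ofReal t ^ n =
      ENNReal.ofReal (Real.exp (c + t)) := by
  have hterm : ∀ n : ℕ, ENNReal.ofReal (Real.exp c) / n.factorial * ENNReal.ofReal t ^ n =
      ENNReal.ofReal (Real.exp c) * ENNReal.ofReal (t ^ n / n.factorial) := fun n => by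
    rw [ENNReal.ofReal_div_of_pos (by positivity), ENNReal.ofReal_pow ht,
      ENNReal.ofReal_natCast, ← ENNReal.mul_div_right_comm, mul_div_assoc]
  simp only [hterm]
  rw [ENNReal.tsum_mul_left, ← ENNReal.ofReal_tsum_of_nonneg (fun n => by positivity)
    (Real.summable_pow_div_factorial t), ← ENNReal.ofReal_mul (by positivity), Real.exp_add,
    Real.exp_eq_exp_ℝ, NormedSpace.exp_eq_tsum_div]

theorem poissonExpectation_prod_one_sub {v : E → ℝ} (hv : Measurable v)
    (hv_int : Integrable v ν) (hv1 : ∀ a, v a ≤ 1) :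
    poissonExpectation ν (fun _ x => ∏ k, ENNReal.ofReal (1 - v (x k))) =
      ENNReal.ofReal (Real.exp (-∫ a, v a ∂ν)) := by
  have hnonneg : ∀ a, 0 ≤ 1 - v a := fun a => sub_nonneg.2 (hv1 a)
  have hint : ∫⁻ a, ENNReal.ofReal (1 - v a) ∂ν = ENNReal.ofReal (∫ a, (1 - v a) ∂ν) :=
    (ofReal_integral_eq_lintegral_ofReal ((integrable_const _).sub hv_int)
      (ae_of_all _ hnonneg)).symm
  have hm : Measurable fun a => ENNReal.ofReal (1 - v a) := (measurable_const.sub hv).ennreal_ofReal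
  simp only [poissonExpectation, lintegral_pi_prod hm, hint]
  rw [tsum_div_factorial_mul_pow _ (integral_nonneg hnonneg),
    integral_sub (integrable_const _) hv_int, integral_const, smul_eq_mul, mul_one,
    sub_eq_add_neg, neg_add_cancel_left]

theorem poissonExpectation_const {c : ℝ≥0∞} (hc : c ≠ ⊤) :
    poissonExpectation ν (fun _ _ => c) = c := by
  have hone : poissonExpectation ν (fun _ _ => 1) = 1 := by
    simpa using poissonExpectation_prod_one_sub (ν := ν) (v := fun _ => 0) measurable_const
      (integrable_zero _ _ _) fun _ => zero_le_one
  simpa only [mul_one, hone] using poissonExpectation_const_mul (ν := ν) hc fun _ _ => 1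

theorem poissonExpectation_card :
    poissonExpectation ν (fun n _ => n) = ν Set.univ := by
  have hcard : (fun n (_ : Fin n → E) => (n : ℝ≥0∞)) = pointSum fun _ _ _ => 1 := by
    ext (_ | n) x <;> simp [pointSum]
  rw [hcard, poissonExpectation_pointSum fun _ => measurable_const]
  simp only [poissonExpectation_const ENNReal.one_ne_top, lintegral_one]

end PoissonExpectation

section PairProducts

open Classical in
theorem sum_simpleGraph_prod_sym2 {ι R : Type*} [DecidableEq ι] [Fintype ι] [CommSemiring R]
    (F : Sym2 ι → Prop → R) :
    ∑ g : SimpleGraph ι, ∏ e : Sym2 ι with ¬ e.IsDiag, F e (e ∈ g.edgeSet) =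
      ∏ e : Sym2 ι with ¬ e.IsDiag, (F e True + F e False) := by
  rw [Finset.prod_add]
  refine Finset.sum_bij' (fun g _ => g.edgeFinset) (fun t _ => SimpleGraph.fromEdgeSet t)
    ?_ ?_ ?_ ?_ ?_
  · intro g _
    refine Finset.mem_powerset.2 fun e he => ?_
    simpa using g.not_isDiag_of_mem_edgeFinset he
  · simp
  · simp
  · intro t ht
    ext e
    have hdiag : e ∈ t → ¬ e.IsDiag := fun he => by simpa using Finset.mem_powerset.1 ht he
    simpa using hdiag
  · intro g _
    rw [← Finset.prod_sdiff (s₁ := g.edgeFinset), mul_comm]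
    · congr 1
      · exact Finset.prod_congr rfl fun e he => by simp [SimpleGraph.mem_edgeFinset.1 he]
      · exact Finset.prod_congr rfl fun e he => by
          simp [mt SimpleGraph.mem_edgeFinset.2 (Finset.mem_sdiff.1 he).2]
    · exact fun e he => by simpa using g.not_isDiag_of_mem_edgeFinset he

/-- The product of `u a b` over all pairs `a < b`. -/
noncomputable def pairProd {ι M : Type*} [LinearOrder ι] [Fintype ι] [CommMonoid M]
    (u : ι → ι → M) : M :=
  ∏ p : ι × ι with p.1 < p.2, u p.1 p.2

section CommMonoid

variable {ι M : Type*} [LinearOrder ι] [Fintype ι] [CommMonoid M]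

theorem pairProd_congr {u v : ι → ι → M} (h : ∀ a b, a ≠ b → u a b = v a b) :
    pairProd u = pairProd v :=
  Finset.prod_congr rfl fun _ hp => h _ _ (Finset.mem_filter.1 hp).2.ne

theorem pairProd_one : pairProd (fun _ _ : ι => (1 : M)) = 1 :=
  Finset.prod_const_one

theorem pairProd_mul (u v : ι → ι → M) :
    pairProd (fun a b => u a b * v a b) = pairProd u * pairProd v :=
  Finset.prod_mul_distrib

theorem pairProd_eq_prod_sym2 (u : ι → ι → M) (hu : ∀ a b, u a b = u b a) :
    pairProd u = ∏ e : Sym2 ι with ¬ e.IsDiag, Sym2.lift ⟨u, hu⟩ e := by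
  have hlt : (Finset.univ : Finset ι).offDiag.filter (fun p => p.1 < p.2) =
      (Finset.univ : Finset (ι × ι)).filter fun p => p.1 < p.2 := by
    ext p
    simpa using fun h : p.1 < p.2 => h.ne
  rw [pairProd, ← hlt, ← Finset.sym2_univ]
  exact (Finset.sum_sym2_filter_not_isDiag (M := Additive M) Finset.univ
    fun e => Additive.ofMul (Sym2.lift ⟨u, hu⟩ e)).symm

theorem pairProd_comp_perm (u : ι → ι → M) (hu : ∀ a b, u a b = u b a) (σ : Equiv.Perm ι) :
    pairProd (fun a b => u (σ a) (σ b)) = pairProd u := by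
  rw [pairProd_eq_prod_sym2 _ hu, pairProd_eq_prod_sym2 _ fun a b => hu _ _]
  refine Finset.prod_bijective (Sym2.map σ)
    (Finite.injective_iff_bijective.1 (Sym2.map.injective σ.injective)) (fun e => ?_)
    fun e _ => Sym2.ind (fun a b => rfl) e
  simp [Sym2.isDiag_map σ.injective]

theorem pairProd_succAbove {n : ℕ} (u : Fin (n + 1) → Fin (n + 1) → M)
    (hu : ∀ a b, u a b = u b a) (i : Fin (n + 1)) :
    pairProd u = (∏ k, u i (i.succAbove k)) *
      pairProd fun a b => u (i.succAbove a) (i.succAbove b) := by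
  simp only [pairProd, Finset.prod_filter, Fintype.prod_prod_type]
  rw [Fin.prod_univ_succAbove _ i, Fin.prod_univ_succAbove _ i]
  simp only [lt_irrefl, if_false, one_mul]
  have hrow : ∀ a : Fin n, (∏ b, if i.succAbove a < b then u (i.succAbove a) b else 1) =
      (if i.succAbove a < i then u i (i.succAbove a) else 1) *
        ∏ b, if a < b then u (i.succAbove a) (i.succAbove b) else 1 := fun a => by
    rw [Fin.prod_univ_succAbove _ i, hu]
    simp [(Fin.strictMono_succAbove i).lt_iff_lt]
  simp only [hrow, Finset.prod_mul_distrib]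
  rw [← mul_assoc, ← Finset.prod_mul_distrib]
  congr 1
  refine Finset.prod_congr rfl fun k _ => ?_
  rcases lt_or_gt_of_ne (Fin.succAbove_ne i k) with h | h <;> simp [h, h.le]

end CommMonoid

section CommSemiring

variable {ι R : Type*} [LinearOrder ι] [Fintype ι] [CommSemiring R]

theorem pairProd_ite_one_zero {c : ι → ι → Prop} [∀ a b, Decidable (c a b)]
    [Decidable (∀ a b, a ≠ b → c a b)] (hc : ∀ a b, c a b ↔ c b a) :
    pairProd (fun a b => if c a b then (1 : R) else 0) =
      if ∀ a b, a ≠ b → c a b then 1 else 0 := by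
  have hlt : (∀ a b, a ≠ b → c a b) ↔ ∀ p ∈ Finset.univ.filter fun p : ι × ι => p.1 < p.2,
      c p.1 p.2 := by
    simp only [Finset.mem_filter, Finset.mem_univ, true_and, Prod.forall]
    refine ⟨fun h a b hab => h a b hab.ne, fun h a b hab => ?_⟩
    exact hab.lt_or_gt.elim (h a b) fun hba => (hc a b).2 (h b a hba)
  simp only [hlt]
  exact Finset.prod_ite_zero.trans (by simp)

open Classical in
theorem sum_simpleGraph_pairProd {f : ι → ι → Prop → R} (hf : ∀ a b, f a b = f b a) :
    ∑ g : SimpleGraph ι, pairProd (fun a b => f a b (g.Adj a b)) =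
      pairProd fun a b => f a b True + f a b False := by
  let F : Sym2 ι → Prop → R := Sym2.lift ⟨f, hf⟩
  have hadj : ∀ g : SimpleGraph ι, pairProd (fun a b => f a b (g.Adj a b)) =
      ∏ e : Sym2 ι with ¬ e.IsDiag, F e (e ∈ g.edgeSet) := fun g => by
    rw [pairProd_eq_prod_sym2 _ fun a b => by rw [hf, g.adj_comm]]
    exact Finset.prod_congr rfl fun e _ => Sym2.ind (fun a b => rfl) e
  rw [pairProd_eq_prod_sym2 _ fun a b => by rw [hf]]
  rw [Finset.sum_congr rfl fun g _ => hadj g, sum_simpleGraph_prod_sym2]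
  exact Finset.prod_congr rfl fun e _ => Sym2.ind (fun a b => rfl) e

end CommSemiring

end PairProducts

/-- A symmetric function with values in `[0, 1]`, giving the probability that two points are
joined. -/
structure IsConnectionFunction {E : Type*} (h : E → E → ℝ) : Prop where
  symm : ∀ a b, h a b = h b a
  nonneg : ∀ a b, 0 ≤ h a b
  le_one : ∀ a b, h a b ≤ 1

/-- The expected value of `φ g`, where `g` is the random graph on the points `x 0, …, x (n - 1)` in
which pairs are joined independently with probabilities given by `h`. -/
noncomputable def graphExpectation {E : Type*} (h : E → E → ℝ) {n : ℕ} (x : Fin n → E)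
    (φ : SimpleGraph (Fin n) → ℝ≥0∞) : ℝ≥0∞ :=
  ∑ g, ENNReal.ofReal (graphProb h x g) * φ g

section GraphExpectation

variable {E : Type*} {h : E → E → ℝ} {n : ℕ}

theorem graphExpectation_add (x : Fin n → E) (φ ψ : SimpleGraph (Fin n) → ℝ≥0∞) :
    graphExpectation h x (fun g => φ g + ψ g) =
      graphExpectation h x φ + graphExpectation h x ψ := by
  simp only [graphExpectation, mul_add, Finset.sum_add_distrib]

theorem graphExpectation_sum {κ : Type*} (s : Finset κ) (x : Fin n → E)
    (φ : κ → SimpleGraph (Fin n) → ℝ≥0∞) :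
    graphExpectation h x (fun g => ∑ i ∈ s, φ i g) = ∑ i ∈ s, graphExpectation h x (φ i) := by
  simp only [graphExpectation, Finset.mul_sum]
  exact Finset.sum_comm

theorem graphProb_comap_perm (hsymm : ∀ a b, h a b = h b a) (σ : Equiv.Perm (Fin n))
    (x : Fin n → E) (g : SimpleGraph (Fin n)) :
    graphProb h (x ∘ σ) (g.comap σ) = graphProb h x g := by
  classical
  exact pairProd_comp_perm (fun a b => if g.Adj a b then h (x a) (x b) else 1 - h (x a) (x b))
    (fun a b => by rw [g.adj_comm, hsymm]) σ

theorem graphExpectation_comp_perm (hsymm : ∀ a b, h a b = h b a) (σ : Equiv.Perm (Fin n))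
    (x : Fin n → E) {φ : SimpleGraph (Fin n) → ℝ≥0∞} (hφ : ∀ g, φ (g.comap σ) = φ g) :
    graphExpectation h (x ∘ σ) φ = graphExpectation h x φ :=
  (Fintype.sum_equiv (Equiv.simpleGraph σ.symm) _ _ fun g => by
    change _ = ENNReal.ofReal (graphProb h (x ∘ σ) (g.comap σ)) * φ (g.comap σ)
    rw [graphProb_comap_perm hsymm, hφ]).symm

open Classical in
theorem ofReal_graphProb (hh : IsConnectionFunction h) (x : Fin n → E)
    (g : SimpleGraph (Fin n)) :
    ENNReal.ofReal (graphProb h x g) = pairProd fun a b =>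
      if g.Adj a b then ENNReal.ofReal (h (x a) (x b)) else ENNReal.ofReal (1 - h (x a) (x b)) := by
  rw [graphProb, ENNReal.ofReal_prod_of_nonneg fun p _ => by
    split_ifs
    exacts [hh.nonneg _ _, sub_nonneg.2 (hh.le_one _ _)]]
  exact Finset.prod_congr rfl fun p _ => apply_ite _ _ _ _

theorem IsConnectionFunction.ofReal_add_ofReal_one_sub (hh : IsConnectionFunction h) (a b : E) :
    ENNReal.ofReal (h a b) + ENNReal.ofReal (1 - h a b) = 1 := by
  rw [← ENNReal.ofReal_add (hh.nonneg a b) (sub_nonneg.2 (hh.le_one a b)), add_sub_cancel,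
    ENNReal.ofReal_one]

theorem graphExpectation_pairProd (hh : IsConnectionFunction h) (x : Fin n → E)
    {w : Fin n → Fin n → Prop → ℝ≥0∞} (hw : ∀ a b, w a b = w b a) :
    graphExpectation h x (fun g => pairProd fun a b => w a b (g.Adj a b)) =
      pairProd fun a b => ENNReal.ofReal (h (x a) (x b)) * w a b True +
        ENNReal.ofReal (1 - h (x a) (x b)) * w a b False := by
  classical
  let f : Fin n → Fin n → Prop → ℝ≥0∞ := fun a b p =>
    (if p then ENNReal.ofReal (h (x a) (x b)) else ENNReal.ofReal (1 - h (x a) (x b))) * w a b p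
  have hf : ∀ a b, f a b = f b a := fun a b => by simp only [f, hh.symm (x a), hw a]
  have hweight : ∀ g : SimpleGraph (Fin n), ENNReal.ofReal (graphProb h x g) *
      pairProd (fun a b => w a b (g.Adj a b)) = pairProd fun a b => f a b (g.Adj a b) := fun g => by
    rw [ofReal_graphProb hh, ← pairProd_mul]
  rw [graphExpectation, Finset.sum_congr rfl fun g _ => hweight g, sum_simpleGraph_pairProd hf]
  simp only [f, if_true, if_false]

open Classical in
theorem graphExpectation_indicator_isolated (hh : IsConnectionFunction h) (x : Fin n → E)
    (T : Finset (Fin n)) :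
    graphExpectation h x ({g | ∀ i ∈ T, ∀ j, ¬ g.Adj i j}.indicator 1) =
      pairProd fun a b => if a ∈ T ∨ b ∈ T then ENNReal.ofReal (1 - h (x a) (x b)) else 1 := by
  have hiso : ∀ g : SimpleGraph (Fin n), (∀ i ∈ T, ∀ j, ¬ g.Adj i j) ↔
      ∀ a b, a ≠ b → a ∈ T ∨ b ∈ T → ¬ g.Adj a b := fun g =>
    ⟨fun H a b _ hT hab => hT.elim (fun ha => H a ha b hab) fun hb => H b hb a hab.symm,
      fun H i hi j hij => H i j hij.ne (Or.inl hi) hij⟩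
  have hprod : ({g | ∀ i ∈ T, ∀ j, ¬ g.Adj i j}.indicator 1 : SimpleGraph (Fin n) → ℝ≥0∞) =
      fun g => pairProd fun a b => if a ∈ T ∨ b ∈ T → ¬ g.Adj a b then 1 else 0 := by
    ext g
    rw [pairProd_ite_one_zero (c := fun a b => a ∈ T ∨ b ∈ T → ¬ g.Adj a b)
      fun a b => by rw [or_comm, g.adj_comm]]
    simp only [Set.indicator_apply, Set.mem_ofPred_eq, hiso, Pi.one_apply]
  rw [hprod, graphExpectation_pairProd hh x
    (w := fun a b p => if a ∈ T ∨ b ∈ T → ¬ p then 1 else 0) fun a b => by simp only [or_comm]]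
  refine pairProd_congr fun a b _ => ?_
  by_cases hT : a ∈ T ∨ b ∈ T <;> simp [hT, hh.ofReal_add_ofReal_one_sub]

theorem graphExpectation_one (hh : IsConnectionFunction h) (x : Fin n → E) :
    graphExpectation h x (fun _ => 1) = 1 := by
  classical
  simpa [pairProd_one, Pi.one_def] using graphExpectation_indicator_isolated hh x ∅

theorem graphExpectation_indicator_isolated_one (hh : IsConnectionFunction h)
    (x : Fin (n + 1) → E) (i : Fin (n + 1)) :
    graphExpectation h x ({g | ∀ j, ¬ g.Adj i j}.indicator 1) =
      ∏ k, ENNReal.ofReal (1 - h (x i) (i.removeNth x k)) := by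
  classical
  have hT := graphExpectation_indicator_isolated hh x {i}
  simp only [Finset.mem_singleton, forall_eq] at hT
  rw [hT, pairProd_succAbove _ (fun a b => by simp only [hh.symm (x a), or_comm]) i]
  simp [Fin.succAbove_ne, pairProd_one, Fin.removeNth]

theorem graphExpectation_indicator_isolated_two (hh : IsConnectionFunction h)
    (x : Fin (n + 2) → E) (i : Fin (n + 2)) (j : Fin (n + 1)) :
    graphExpectation h x
        ({g | (∀ k, ¬ g.Adj i k) ∧ ∀ k, ¬ g.Adj (i.succAbove j) k}.indicator 1) =
      ENNReal.ofReal (1 - h (x i) (i.removeNth x j)) *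
        ∏ k, ENNReal.ofReal (1 - h (x i) (j.removeNth (i.removeNth x) k)) *
          ENNReal.ofReal (1 - h (i.removeNth x j) (j.removeNth (i.removeNth x) k)) := by
  classical
  have hT := graphExpectation_indicator_isolated hh x {i, i.succAbove j}
  simp only [Finset.mem_insert, Finset.mem_singleton, forall_eq_or_imp, forall_eq] at hT
  have hsymm : ∀ a b, (if (a = i ∨ a = i.succAbove j) ∨ b = i ∨ b = i.succAbove j then
      ENNReal.ofReal (1 - h (x a) (x b)) else 1) =
      if (b = i ∨ b = i.succAbove j) ∨ a = i ∨ a = i.succAbove j then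
      ENNReal.ofReal (1 - h (x b) (x a)) else 1 := fun a b => by
    simp only [hh.symm (x a), or_comm]
  rw [hT, pairProd_succAbove _ hsymm i, pairProd_succAbove _ (fun a b => hsymm _ _) j,
    Fin.prod_univ_succAbove _ j, Finset.prod_mul_distrib]
  simp [Fin.succAbove_ne, pairProd_one, Fin.removeNth, mul_assoc]

theorem graphExpectation_indicator_adj (hh : IsConnectionFunction h)
    (x : Fin (n + 1) → E) (i : Fin (n + 1)) (j : Fin n) :
    graphExpectation h x ({g | g.Adj i (i.succAbove j)}.indicator 1) =
      ENNReal.ofReal (h (x i) (i.removeNth x j)) := by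
  classical
  have hswap : ∀ a b : Fin (n + 1), s(a, b) = s(b, a) := fun a b => Sym2.eq_swap
  have hadj : ∀ g : SimpleGraph (Fin (n + 1)), g.Adj i (i.succAbove j) ↔
      ∀ a b, a ≠ b → s(a, b) = s(i, i.succAbove j) → g.Adj a b := fun g =>
    ⟨fun H a b _ hab => by rwa [← g.mem_edgeSet, hab],
      fun H => H i _ (Fin.succAbove_ne i j).symm rfl⟩
  have hprod : ({g | g.Adj i (i.succAbove j)}.indicator 1 : SimpleGraph (Fin (n + 1)) → ℝ≥0∞) =
      fun g => pairProd fun a b => if s(a, b) = s(i, i.succAbove j) → g.Adj a b then 1 else 0 := by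
    ext g
    rw [pairProd_ite_one_zero (c := fun a b => s(a, b) = s(i, i.succAbove j) → g.Adj a b)
      fun a b => by rw [hswap, g.adj_comm]]
    simp only [Set.indicator_apply, Set.mem_ofPred_eq, hadj, Pi.one_apply]
  rw [hprod, graphExpectation_pairProd hh x
      (w := fun a b p => if s(a, b) = s(i, i.succAbove j) → p then 1 else 0)
      fun a b => by rw [hswap],
    pairProd_succAbove _ (fun a b => by rw [hswap, hh.symm]) i,
    pairProd_congr (v := fun _ _ => 1), pairProd_one, mul_one]
  · rw [Finset.prod_eq_single j (fun k _ hk => ?_) (by simp)]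
    · simp [Fin.removeNth]
    · simp [hk, hh.ofReal_add_ofReal_one_sub]
  · intro a b _
    simp [Fin.succAbove_ne, hh.ofReal_add_ofReal_one_sub]

end GraphExpectation

/-- The sum of the degrees of all nodes of the graph that `G` induces on `V`. -/
noncomputable def degreeSum {E : Type*} (V : Finset E) (G : SimpleGraph E) : ℕ :=
  ∑ x ∈ V, {y : E | y ∈ V ∧ G.Adj x y}.ncard

section GraphFunctionals

variable {n : ℕ}

theorem sum_indicator_one_apply {ι α : Type*} [Fintype ι] (S : ι → Set α) (a : α) :
    ∑ i, (S i).indicator (1 : α → ℝ≥0∞) a = ({i | a ∈ S i}.ncard : ℕ) := by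
  classical
  simp only [Set.indicator_apply, Pi.one_apply, Finset.sum_boole, Set.ncard_eq_toFinset_card',
    Set.toFinset_ofPred]

theorem numIsolated_univ (g : SimpleGraph (Fin n)) :
    (numIsolated Finset.univ g : ℝ≥0∞) = ∑ i, {g | ∀ j, ¬ g.Adj i j}.indicator 1 g := by
  have hset : {i | i ∈ Finset.univ ∧ ∀ j ∈ Finset.univ, j ≠ i → ¬ g.Adj i j} =
      {i | ∀ j, ¬ g.Adj i j} := by
    ext i
    simp only [Finset.mem_univ, true_and, forall_const, Set.mem_ofPred_eq]
    exact ⟨fun H j hij => H j hij.ne' hij, fun H j _ => H j⟩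
  rw [numIsolated, hset, sum_indicator_one_apply]
  rfl

theorem numIsolated_univ_sq (g : SimpleGraph (Fin (n + 1))) :
    (numIsolated Finset.univ g : ℝ≥0∞) ^ 2 = numIsolated Finset.univ g + ∑ i, ∑ j : Fin n,
      {g | (∀ k, ¬ g.Adj i k) ∧ ∀ k, ¬ g.Adj (i.succAbove j) k}.indicator 1 g := by
  have hdiag : ∀ i, ({g | ∀ k, ¬ g.Adj i k}.indicator 1 g : ℝ≥0∞) *
      {g | ∀ k, ¬ g.Adj i k}.indicator 1 g = {g | ∀ k, ¬ g.Adj i k}.indicator 1 g := fun i => by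
    rw [← Pi.mul_apply, ← Set.inter_indicator_one, Set.inter_self]
  have hoff : ∀ i (j : Fin n), ({g | ∀ k, ¬ g.Adj i k}.indicator 1 g : ℝ≥0∞) *
      {g | ∀ k, ¬ g.Adj (i.succAbove j) k}.indicator 1 g =
        {g | (∀ k, ¬ g.Adj i k) ∧ ∀ k, ¬ g.Adj (i.succAbove j) k}.indicator 1 g := fun i j =>
    (congrFun Set.inter_indicator_one g).symm
  rw [numIsolated_univ, sq, Finset.sum_mul_sum, ← Finset.sum_add_distrib]
  refine Finset.sum_congr rfl fun i _ => ?_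
  rw [Fin.sum_univ_succAbove _ i, hdiag]
  simp only [hoff]

theorem degreeSum_univ (g : SimpleGraph (Fin (n + 1))) :
    (degreeSum Finset.univ g : ℝ≥0∞) =
      ∑ i, ∑ j : Fin n, {g | g.Adj i (i.succAbove j)}.indicator 1 g := by
  rw [degreeSum, Nat.cast_sum]
  refine Finset.sum_congr rfl fun i _ => ?_
  have hsplit := sum_indicator_one_apply (fun j => {g : SimpleGraph (Fin (n + 1)) | g.Adj i j}) g
  rw [Fin.sum_univ_succAbove _ i] at hsplit
  simpa using hsplit.symm

variable {E : Type*} {h : E → E → ℝ}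

theorem graphExpectation_numIsolated (hh : IsConnectionFunction h) : ∀ {n} (x : Fin n → E),
    graphExpectation h x (fun g => numIsolated Finset.univ g) =
      pointSum (fun a _ y => ∏ k, ENNReal.ofReal (1 - h a (y k))) n x
  | 0, x => by simp [graphExpectation, pointSum, numIsolated]
  | n + 1, x => by
    simp only [numIsolated_univ, graphExpectation_sum, pointSum]
    exact Finset.sum_congr rfl fun i _ => graphExpectation_indicator_isolated_one hh x i

theorem graphExpectation_numIsolated_sq (hh : IsConnectionFunction h) : ∀ {n} (x : Fin n → E),
    graphExpectation h x (fun g => (numIsolated Finset.univ g : ℝ≥0∞) ^ 2) =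
      graphExpectation h x (fun g => numIsolated Finset.univ g) +
        pointSum (fun a => pointSum fun b _ y => ENNReal.ofReal (1 - h a b) *
          ∏ k, ENNReal.ofReal (1 - h a (y k)) * ENNReal.ofReal (1 - h b (y k))) n x
  | 0, x => by simp [graphExpectation, pointSum, numIsolated]
  | 1, x => by simp only [numIsolated_univ_sq, pointSum, Finset.univ_eq_empty,
      Finset.sum_empty, Finset.sum_const_zero, add_zero]
  | n + 2, x => by
    simp only [numIsolated_univ_sq, graphExpectation_add, graphExpectation_sum, pointSum,
      graphExpectation_indicator_isolated_two hh]

theorem graphExpectation_degreeSum (hh : IsConnectionFunction h) : ∀ {n} (x : Fin n → E),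
    graphExpectation h x (fun g => degreeSum Finset.univ g) =
      pointSum (fun a => pointSum fun b _ _ => ENNReal.ofReal (h a b)) n x
  | 0, x => by simp [degreeSum, graphExpectation, pointSum]
  | 1, x => by simp only [degreeSum_univ, graphExpectation, pointSum, Finset.univ_eq_empty,
      Finset.sum_empty, Finset.sum_const_zero, mul_zero]
  | n + 2, x => by
    simp only [degreeSum_univ, graphExpectation_sum, pointSum,
      graphExpectation_indicator_adj hh]

end GraphFunctionals

section RandomGraph

variable {Ω E : Type*} {V : Ω → Finset E} {G : Ω → SimpleGraph E} {X : ℕ → Ω → E}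

/-- The random graph with its nodes relabelled by their positions in the enumeration `X`. -/
def labelledGraph (V : Ω → Finset E) (G : Ω → SimpleGraph E) (X : ℕ → Ω → E) (ω : Ω) :
    Σ n, SimpleGraph (Fin n) :=
  ⟨(V ω).card, (G ω).comap fun i => X i ω⟩

theorem labelledGraph_preimage_singleton (n : ℕ) (g : SimpleGraph (Fin n)) :
    labelledGraph V G X ⁻¹' {⟨n, g⟩} =
      {ω | (V ω).card = n ∧ ∀ i j : Fin n, (G ω).Adj (X i ω) (X j ω) ↔ g.Adj i j} := by
  ext ω
  simp only [labelledGraph, Set.mem_preimage, Set.mem_singleton_iff, Set.mem_ofPred_eq,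
    Sigma.mk.injEq]
  refine and_congr_right fun hn => ?_
  subst hn
  simp only [heq_eq_eq, SimpleGraph.ext_iff, funext_iff, SimpleGraph.comap_adj, eq_iff_iff]

variable [MeasurableSpace Ω] [MeasurableSpace E] {P : Measure Ω} {h : E → E → ℝ}

theorem HasIndependentEdges.measurable_labelledGraph (hE : HasIndependentEdges P h V G X) :
    Measurable[_, ⊤] (labelledGraph V G X) := by
  let _ : MeasurableSpace (Σ n, SimpleGraph (Fin n)) := ⊤
  refine measurable_to_countable' fun ⟨n, g⟩ => ?_
  rw [labelledGraph_preimage_singleton]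
  exact hE.measurableSet_graph n g

theorem HasIndependentEdges.measure_labelledGraph_eq (hE : HasIndependentEdges P h V G X)
    (n : ℕ) (g : SimpleGraph (Fin n)) :
    P (labelledGraph V G X ⁻¹' {⟨n, g⟩}) =
      ∫⁻ ω in {ω | (V ω).card = n}, ENNReal.ofReal (graphProb h (fun i => X i ω) g) ∂P := by
  have hset : {ω | (V ω).card = n ∧ (fun i : Fin n => X i ω) ∈ Set.univ} =
      {ω | (V ω).card = n} := by simp
  rw [labelledGraph_preimage_singleton, ← hset, ← hE.law_graph n g Set.univ .univ, hset]
  congr 1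
  ext ω
  exact ⟨fun H => ⟨H.1, H⟩, fun H => H.2⟩

theorem measurable_graphProb (hm : Measurable (Function.uncurry h)) {n : ℕ}
    (g : SimpleGraph (Fin n)) : Measurable fun x => graphProb h x g := by
  refine Finset.measurable_fun_prod _ fun p _ => ?_
  have hp : Measurable fun x : Fin n → E => Function.uncurry h (x p.1, x p.2) :=
    hm.comp ((measurable_pi_apply p.1).prodMk (measurable_pi_apply p.2))
  split_ifs
  exacts [hp, measurable_const.sub hp]

theorem measurable_graphExpectation (hm : Measurable (Function.uncurry h)) {n : ℕ}
    (φ : SimpleGraph (Fin n) → ℝ≥0∞) : Measurable fun x => graphExpectation h x φ :=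
  Finset.measurable_fun_sum _ fun g _ => (measurable_graphProb hm g).ennreal_ofReal.mul_const _

variable {ν : Measure E} [IsFiniteMeasure ν]
  [TopologicalSpace E] [T2Space E] [SecondCountableTopology E] [BorelSpace E]

theorem HasIndependentEdges.lintegral_labelledGraph (hV : IsPoissonProcess P ν V)
    (hE : HasIndependentEdges P h V G X) (hm : Measurable (Function.uncurry h))
    (hsymm : ∀ a b, h a b = h b a) {Φ : (Σ n, SimpleGraph (Fin n)) → ℝ≥0∞}
    (hΦ : ∀ n (g : SimpleGraph (Fin n)) (σ : Equiv.Perm (Fin n)), Φ ⟨n, g.comap σ⟩ = Φ ⟨n, g⟩) :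
    ∫⁻ ω, Φ (labelledGraph V G X ω) ∂P =
      poissonExpectation ν fun n x => graphExpectation h x fun g => Φ ⟨n, g⟩ := by
  have hX : ∀ n, Measurable fun ω (i : Fin n) => X i ω := fun n =>
    measurable_pi_lambda _ fun i => hE.measurable_enum i
  let _ : MeasurableSpace (Σ n, SimpleGraph (Fin n)) := ⊤
  rw [← lintegral_map (measurable_from_top (f := Φ)) hE.measurable_labelledGraph,
    lintegral_countable', ENNReal.tsum_sigma', poissonExpectation]
  refine tsum_congr fun n => ?_
  rw [← hV.setLIntegral_card_eq hE.measurable_enum hE.bijOn_enum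
    (measurable_graphExpectation hm _)
    fun σ x => graphExpectation_comp_perm hsymm σ x fun g => hΦ n g σ]
  have hgm : ∀ g : SimpleGraph (Fin n),
      Measurable fun ω => ENNReal.ofReal (graphProb h (fun i => X i ω) g) := fun g =>
    (measurable_graphProb hm g).ennreal_ofReal.comp (hX n)
  simp only [graphExpectation]
  rw [lintegral_finsetSum _ fun g _ => (hgm g).mul_const _, tsum_fintype]
  refine Finset.sum_congr rfl fun g _ => ?_
  rw [Measure.map_apply hE.measurable_labelledGraph trivial, hE.measure_labelledGraph_eq,
    lintegral_mul_const _ (hgm g), mul_comm]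

end RandomGraph

section Relabelling

variable {α β : Type*}

theorem numIsolated_map (f : α ↪ β) (s : Finset α) (G : SimpleGraph β) :
    numIsolated (s.map f) G = numIsolated s (G.comap f) := by
  rw [numIsolated, numIsolated, ← Set.ncard_image_of_injective _ f.injective]
  congr 1
  ext y
  simp only [Finset.mem_map, Set.mem_ofPred_eq, Set.mem_image, SimpleGraph.comap_adj,
    forall_exists_index, and_imp, forall_apply_eq_imp_iff₂]
  constructor
  · rintro ⟨⟨x, hx, rfl⟩, H⟩
    exact ⟨x, ⟨hx, fun z hz hzx => H z hz (f.injective.ne hzx)⟩, rfl⟩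
  · rintro ⟨x, ⟨hx, H⟩, rfl⟩
    exact ⟨⟨x, hx, rfl⟩, fun z hz hzx => H z hz (ne_of_apply_ne f hzx)⟩

theorem degreeSum_map (f : α ↪ β) (s : Finset α) (G : SimpleGraph β) :
    degreeSum (s.map f) G = degreeSum s (G.comap f) := by
  rw [degreeSum, degreeSum, Finset.sum_map]
  refine Finset.sum_congr rfl fun x _ => ?_
  rw [← Set.ncard_image_of_injective _ f.injective]
  congr 1
  ext y
  simp only [Finset.mem_map, Set.mem_ofPred_eq, Set.mem_image, SimpleGraph.comap_adj]
  constructor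
  · rintro ⟨⟨z, hz, rfl⟩, H⟩
    exact ⟨z, ⟨hz, H⟩, rfl⟩
  · rintro ⟨z, ⟨hz, H⟩, rfl⟩
    exact ⟨⟨z, hz, rfl⟩, H⟩

variable [Fintype α] (σ : Equiv.Perm α) (g : SimpleGraph α)

theorem numIsolated_univ_comap_perm :
    numIsolated Finset.univ (g.comap σ) = numIsolated Finset.univ g := by
  conv_rhs => rw [← Finset.map_univ_equiv σ, numIsolated_map]
  rfl

theorem degreeSum_univ_comap_perm :
    degreeSum Finset.univ (g.comap σ) = degreeSum Finset.univ g := by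
  conv_rhs => rw [← Finset.map_univ_equiv σ, degreeSum_map]
  rfl

end Relabelling

section Moments

variable {Ω E : Type*} [MeasurableSpace Ω] [MeasurableSpace E]
  {P : Measure Ω} {h : E → E → ℝ} {V : Ω → Finset E} {G : Ω → SimpleGraph E} {X : ℕ → Ω → E}

theorem HasIndependentEdges.numIsolated_eq (hE : HasIndependentEdges P h V G X) (ω : Ω) :
    numIsolated (V ω) (G ω) = numIsolated Finset.univ (labelledGraph V G X ω).2 := by
  obtain ⟨f, hf, hV⟩ := exists_embedding_of_bijOn (hE.bijOn_enum ω) rfl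
  conv_lhs => rw [hV, numIsolated_map, show ⇑f = fun i : Fin (V ω).card => X i ω from funext hf]
  rfl

theorem HasIndependentEdges.degreeSum_eq (hE : HasIndependentEdges P h V G X) (ω : Ω) :
    degreeSum (V ω) (G ω) = degreeSum Finset.univ (labelledGraph V G X ω).2 := by
  obtain ⟨f, hf, hV⟩ := exists_embedding_of_bijOn (hE.bijOn_enum ω) rfl
  conv_lhs => rw [hV, degreeSum_map, show ⇑f = fun i : Fin (V ω).card => X i ω from funext hf]
  rfl

theorem HasIndependentEdges.measurable_numIsolated (hE : HasIndependentEdges P h V G X) :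
    Measurable fun ω => numIsolated (V ω) (G ω) := by
  simp only [hE.numIsolated_eq]
  exact (measurable_from_top (f := fun s : Σ n, SimpleGraph (Fin n) =>
    numIsolated Finset.univ s.2)).comp hE.measurable_labelledGraph

variable {ν : Measure E} [IsFiniteMeasure ν]

theorem IsConnectionFunction.integrable (hh : IsConnectionFunction h)
    (hm : Measurable (Function.uncurry h)) (a : E) : Integrable (h a) ν :=
  .of_bound (hm.comp measurable_prodMk_left).aestronglyMeasurable 1 <|
    ae_of_all _ fun b => by
      rw [Real.norm_of_nonneg (hh.nonneg a b)]
      exact hh.le_one a b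

theorem IsConnectionFunction.integrable_mul (hh : IsConnectionFunction h)
    (hm : Measurable (Function.uncurry h)) (a b : E) : Integrable (fun z => h a z * h b z) ν :=
  (hh.integrable hm b).bdd_mul (hm.comp measurable_prodMk_left).aestronglyMeasurable (c := 1) <|
    ae_of_all _ fun z => by
      rw [Real.norm_of_nonneg (hh.nonneg a z)]
      exact hh.le_one a z

theorem poissonExpectation_pointSum_isolated (hh : IsConnectionFunction h)
    (hm : Measurable (Function.uncurry h)) :
    poissonExpectation ν (pointSum fun a _ y => ∏ k, ENNReal.ofReal (1 - h a (y k))) =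
      ∫⁻ a, ENNReal.ofReal (Real.exp (-∫ z, h a z ∂ν)) ∂ν := by
  rw [poissonExpectation_pointSum fun n => by fun_prop]
  exact lintegral_congr fun a => poissonExpectation_prod_one_sub
    (hm.comp measurable_prodMk_left) (hh.integrable hm a) (hh.le_one a)

theorem poissonExpectation_pointSum_isolated_pair (hh : IsConnectionFunction h)
    (hm : Measurable (Function.uncurry h)) :
    poissonExpectation ν (pointSum fun a => pointSum fun b _ y => ENNReal.ofReal (1 - h a b) *
        ∏ k, ENNReal.ofReal (1 - h a (y k)) * ENNReal.ofReal (1 - h b (y k))) =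
      ∫⁻ a, ∫⁻ b, ENNReal.ofReal (1 - h a b) * ENNReal.ofReal
        (Real.exp (-∫ z, (h a z + h b z - h a z * h b z) ∂ν)) ∂ν ∂ν := by
  have hmul : ∀ a b z, ENNReal.ofReal (1 - h a z) * ENNReal.ofReal (1 - h b z) =
      ENNReal.ofReal (1 - (h a z + h b z - h a z * h b z)) := fun a b z => by
    rw [← ENNReal.ofReal_mul (sub_nonneg.2 (hh.le_one a z))]
    congr 1
    ring
  have hma : ∀ a, Measurable (h a) := fun a => hm.comp measurable_prodMk_left
  rw [poissonExpectation_pointSum (measurable_pointSum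
    (g := fun a b _ y => ENNReal.ofReal (1 - h a b) *
      ∏ k, ENNReal.ofReal (1 - h a (y k)) * ENNReal.ofReal (1 - h b (y k)))
    fun n => by fun_prop)]
  refine lintegral_congr fun a => ?_
  rw [poissonExpectation_pointSum fun n => by fun_prop]
  refine lintegral_congr fun b => ?_
  rw [poissonExpectation_const_mul ENNReal.ofReal_ne_top]
  simp only [hmul]
  congr 1
  refine poissonExpectation_prod_one_sub (((hma a).add (hma b)).sub ((hma a).mul (hma b)))
    (((hh.integrable hm a).add (hh.integrable hm b)).sub (hh.integrable_mul hm a b)) fun z => ?_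
  rw [Pi.sub_apply, Pi.add_apply, Pi.mul_apply]
  nlinarith [mul_nonneg (sub_nonneg.2 (hh.le_one a z)) (sub_nonneg.2 (hh.le_one b z))]

variable [TopologicalSpace E] [T2Space E] [SecondCountableTopology E] [BorelSpace E]

theorem HasIndependentEdges.lintegral_numIsolated (hV : IsPoissonProcess P ν V)
    (hE : HasIndependentEdges P h V G X) (hm : Measurable (Function.uncurry h))
    (hh : IsConnectionFunction h) :
    ∫⁻ ω, (numIsolated (V ω) (G ω) : ℝ≥0∞) ∂P =
      ∫⁻ a, ENNReal.ofReal (Real.exp (-∫ z, h a z ∂ν)) ∂ν := by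
  simp only [hE.numIsolated_eq]
  rw [hE.lintegral_labelledGraph hV hm hh.symm (Φ := fun s => numIsolated Finset.univ s.2)
    fun n g σ => by rw [numIsolated_univ_comap_perm]]
  simp only [graphExpectation_numIsolated hh]
  exact poissonExpectation_pointSum_isolated hh hm

theorem HasIndependentEdges.lintegral_numIsolated_sq (hV : IsPoissonProcess P ν V)
    (hE : HasIndependentEdges P h V G X) (hm : Measurable (Function.uncurry h))
    (hh : IsConnectionFunction h) :
    ∫⁻ ω, (numIsolated (V ω) (G ω) : ℝ≥0∞) ^ 2 ∂P =
      ∫⁻ a, ENNReal.ofReal (Real.exp (-∫ z, h a z ∂ν)) ∂ν +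
        ∫⁻ a, ∫⁻ b, ENNReal.ofReal (1 - h a b) * ENNReal.ofReal
          (Real.exp (-∫ z, (h a z + h b z - h a z * h b z) ∂ν)) ∂ν ∂ν := by
  simp only [hE.numIsolated_eq]
  rw [hE.lintegral_labelledGraph hV hm hh.symm
    (Φ := fun s => (numIsolated Finset.univ s.2 : ℝ≥0∞) ^ 2)
    fun n g σ => by rw [numIsolated_univ_comap_perm]]
  simp only [graphExpectation_numIsolated_sq hh]
  rw [poissonExpectation_add fun n => measurable_graphExpectation hm _,
    poissonExpectation_pointSum_isolated_pair hh hm]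
  simp only [graphExpectation_numIsolated hh, poissonExpectation_pointSum_isolated hh hm]

theorem HasIndependentEdges.lintegral_degreeSum (hV : IsPoissonProcess P ν V)
    (hE : HasIndependentEdges P h V G X) (hm : Measurable (Function.uncurry h))
    (hh : IsConnectionFunction h) :
    ∫⁻ ω, (degreeSum (V ω) (G ω) : ℝ≥0∞) ∂P = ∫⁻ a, ∫⁻ b, ENNReal.ofReal (h a b) ∂ν ∂ν := by
  simp only [hE.degreeSum_eq]
  rw [hE.lintegral_labelledGraph hV hm hh.symm (Φ := fun s => degreeSum Finset.univ s.2)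
    fun n g σ => by rw [degreeSum_univ_comap_perm]]
  simp only [graphExpectation_degreeSum hh]
  rw [poissonExpectation_pointSum (measurable_pointSum (g := fun a b _ _ => ENNReal.ofReal (h a b))
    fun n => by fun_prop)]
  refine lintegral_congr fun a => ?_
  rw [poissonExpectation_pointSum fun n => by fun_prop]
  exact lintegral_congr fun b => poissonExpectation_const ENNReal.ofReal_ne_top

theorem HasIndependentEdges.lintegral_card (hV : IsPoissonProcess P ν V)
    (hE : HasIndependentEdges P h V G X) (hm : Measurable (Function.uncurry h))
    (hh : IsConnectionFunction h) :
    ∫⁻ ω, ((V ω).card : ℝ≥0∞) ∂P = ν Set.univ := by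
  have hconst : ∀ (n : ℕ) (x : Fin n → E), graphExpectation h x (fun _ => n) = n := fun n x => by
    simpa only [graphExpectation, ← Finset.sum_mul, one_mul, mul_one] using
      congrArg (· * (n : ℝ≥0∞)) (graphExpectation_one hh x)
  have hcard := hE.lintegral_labelledGraph hV hm hh.symm (Φ := fun s => s.1) fun n g σ => rfl
  simp only [hconst, poissonExpectation_card] at hcard
  exact hcard

end Moments

section Homogeneous

variable {Ω E : Type*} [MeasurableSpace Ω] [MeasurableSpace E]
  {P : Measure Ω} {h : E → E → ℝ} {V : Ω → Finset E} {G : Ω → SimpleGraph E} {X : ℕ → Ω → E}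
  {ν : Measure E} [IsFiniteMeasure ν] {d : ℝ}

theorem exp_le_one_add_mul_exp {c d : ℝ} (hc : 0 ≤ c) (hcd : c ≤ d) :
    Real.exp c ≤ 1 + c * Real.exp d := by
  have hneg : (1 - c) * Real.exp c ≤ 1 := by
    calc (1 - c) * Real.exp c ≤ Real.exp (-c) * Real.exp c := by
          gcongr
          exact Real.one_sub_le_exp_neg c
      _ = 1 := by rw [← Real.exp_add, neg_add_cancel, Real.exp_zero]
  have hmono : c * Real.exp c ≤ c * Real.exp d := by gcongr
  linarith

theorem IsConnectionFunction.lintegral_ofReal (hh : IsConnectionFunction h)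
    (hm : Measurable (Function.uncurry h)) (a : E) :
    ∫⁻ z, ENNReal.ofReal (h a z) ∂ν = ENNReal.ofReal (∫ z, h a z ∂ν) :=
  (ofReal_integral_eq_lintegral_ofReal (hh.integrable hm a) (ae_of_all _ (hh.nonneg a))).symm

theorem IsConnectionFunction.integral_mul_le (hh : IsConnectionFunction h)
    (hm : Measurable (Function.uncurry h)) (a b : E) :
    ∫ z, h a z * h b z ∂ν ≤ ∫ z, h a z ∂ν :=
  integral_mono (hh.integrable_mul hm a b) (hh.integrable hm a) fun z =>
    mul_le_of_le_one_right (hh.nonneg a z) (hh.le_one b z)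

theorem lintegral_ofReal_integral_mul (hh : IsConnectionFunction h)
    (hm : Measurable (Function.uncurry h)) (hd : ∀ a, ∫ z, h a z ∂ν = d) (a : E) :
    ∫⁻ b, ENNReal.ofReal (∫ z, h a z * h b z ∂ν) ∂ν = ENNReal.ofReal (d ^ 2) := by
  have hprod : ∀ b, ENNReal.ofReal (∫ z, h a z * h b z ∂ν) =
      ∫⁻ z, ENNReal.ofReal (h a z) * ENNReal.ofReal (h b z) ∂ν := fun b => by
    rw [ofReal_integral_eq_lintegral_ofReal (hh.integrable_mul hm a b)
      (ae_of_all _ fun z => mul_nonneg (hh.nonneg a z) (hh.nonneg b z))]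
    exact lintegral_congr fun z => ENNReal.ofReal_mul (hh.nonneg a z)
  have hma : Measurable (h a) := hm.comp measurable_prodMk_left
  have hd0 : 0 ≤ d := hd a ▸ integral_nonneg (hh.nonneg a)
  simp only [hprod]
  rw [lintegral_lintegral_swap
    ((hma.comp measurable_snd).ennreal_ofReal.mul hm.ennreal_ofReal).aemeasurable]
  have hinner : ∀ z, ∫⁻ b, ENNReal.ofReal (h b z) ∂ν = ENNReal.ofReal d := fun z => by
    simp only [hh.symm _ z, hh.lintegral_ofReal hm, hd]
  simp only [lintegral_const_mul' _ _ ENNReal.ofReal_ne_top, hinner]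
  rw [lintegral_mul_const' _ _ ENNReal.ofReal_ne_top, hh.lintegral_ofReal hm, hd,
    ← ENNReal.ofReal_mul hd0, sq]

theorem ofReal_one_sub_mul_exp_le (hh : IsConnectionFunction h)
    (hm : Measurable (Function.uncurry h)) (hd : ∀ a, ∫ z, h a z ∂ν = d) (a b : E) :
    ENNReal.ofReal (1 - h a b) *
        ENNReal.ofReal (Real.exp (-∫ z, (h a z + h b z - h a z * h b z) ∂ν)) ≤
      ENNReal.ofReal (Real.exp (-d) ^ 2) *
        (1 + ENNReal.ofReal (Real.exp d) * ENNReal.ofReal (∫ z, h a z * h b z ∂ν)) := by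
  have hc0 : 0 ≤ ∫ z, h a z * h b z ∂ν :=
    integral_nonneg fun z => mul_nonneg (hh.nonneg a z) (hh.nonneg b z)
  have hcd : ∫ z, h a z * h b z ∂ν ≤ d := hd a ▸ hh.integral_mul_le hm a b
  have hadd : Integrable (fun z => h a z + h b z) ν := (hh.integrable hm a).add (hh.integrable hm b)
  have hsum : -∫ z, (h a z + h b z - h a z * h b z) ∂ν =
      -d + -d + ∫ z, h a z * h b z ∂ν := by
    rw [integral_sub hadd (hh.integrable_mul hm a b),
      integral_add (hh.integrable hm a) (hh.integrable hm b), hd, hd]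
    ring
  rw [hsum, Real.exp_add, Real.exp_add, ← sq]
  calc _ ≤ ENNReal.ofReal (Real.exp (-d) ^ 2 * Real.exp (∫ z, h a z * h b z ∂ν)) :=
        mul_le_of_le_one_left' (ENNReal.ofReal_le_one.2 (sub_le_self _ (hh.nonneg a b)))
    _ ≤ ENNReal.ofReal (Real.exp (-d) ^ 2 * (1 + Real.exp d * ∫ z, h a z * h b z ∂ν)) := by
        rw [mul_comm (Real.exp d)]
        gcongr
        exact exp_le_one_add_mul_exp hc0 hcd
    _ = _ := by
        rw [ENNReal.ofReal_mul (by positivity),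
          ENNReal.ofReal_add zero_le_one (mul_nonneg (Real.exp_nonneg d) hc0), ENNReal.ofReal_one,
          ENNReal.ofReal_mul (Real.exp_nonneg d)]

theorem lintegral_pair_le (hh : IsConnectionFunction h) (hm : Measurable (Function.uncurry h))
    (hd : ∀ a, ∫ z, h a z ∂ν = d) :
    ∫⁻ a, ∫⁻ b, ENNReal.ofReal (1 - h a b) *
        ENNReal.ofReal (Real.exp (-∫ z, (h a z + h b z - h a z * h b z) ∂ν)) ∂ν ∂ν ≤
      ENNReal.ofReal ((ν.real Set.univ * Real.exp (-d)) ^ 2 +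
        d ^ 2 * (ν.real Set.univ * Real.exp (-d))) := by
  have hexp : Real.exp (-d) * Real.exp d = 1 := by
    rw [← Real.exp_add, neg_add_cancel, Real.exp_zero]
  have htot : ENNReal.ofReal (ν.real Set.univ) = ν Set.univ := ofReal_measureReal
  calc _ ≤ ∫⁻ a, ∫⁻ b, ENNReal.ofReal (Real.exp (-d) ^ 2) * (1 + ENNReal.ofReal (Real.exp d) *
          ENNReal.ofReal (∫ z, h a z * h b z ∂ν)) ∂ν ∂ν :=
        lintegral_mono fun a => lintegral_mono fun b => ofReal_one_sub_mul_exp_le hh hm hd a b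
    _ = ENNReal.ofReal (Real.exp (-d) ^ 2) * (ENNReal.ofReal (ν.real Set.univ) +
          ENNReal.ofReal (Real.exp d) * ENNReal.ofReal (d ^ 2)) *
          ENNReal.ofReal (ν.real Set.univ) := by
        simp only [lintegral_const_mul' _ _ ENNReal.ofReal_ne_top,
          lintegral_add_left measurable_const, lintegral_ofReal_integral_mul hh hm hd,
          lintegral_const, one_mul, htot, mul_assoc, add_mul]
    _ = _ := by
        rw [← ENNReal.ofReal_mul (by positivity),
          ← ENNReal.ofReal_add (by positivity) (by positivity),
          ← ENNReal.ofReal_mul (by positivity), ← ENNReal.ofReal_mul (by positivity)]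
        congr 1
        linear_combination Real.exp (-d) * ν.real Set.univ * d ^ 2 * hexp

variable [TopologicalSpace E] [T2Space E] [SecondCountableTopology E] [BorelSpace E]

theorem HasIndependentEdges.lintegral_numIsolated_of_homogeneous (hV : IsPoissonProcess P ν V)
    (hE : HasIndependentEdges P h V G X) (hm : Measurable (Function.uncurry h))
    (hh : IsConnectionFunction h) (hd : ∀ a, ∫ z, h a z ∂ν = d) :
    ∫⁻ ω, (numIsolated (V ω) (G ω) : ℝ≥0∞) ∂P =
      ENNReal.ofReal (ν.real Set.univ * Real.exp (-d)) := by
  rw [hE.lintegral_numIsolated hV hm hh]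
  simp only [hd, lintegral_const]
  rw [mul_comm, ENNReal.ofReal_mul measureReal_nonneg, ofReal_measureReal]

theorem HasIndependentEdges.lintegral_numIsolated_sq_le (hV : IsPoissonProcess P ν V)
    (hE : HasIndependentEdges P h V G X) (hm : Measurable (Function.uncurry h))
    (hh : IsConnectionFunction h) (hd : ∀ a, ∫ z, h a z ∂ν = d) :
    ∫⁻ ω, (numIsolated (V ω) (G ω) : ℝ≥0∞) ^ 2 ∂P ≤
      ENNReal.ofReal ((ν.real Set.univ * Real.exp (-d)) ^ 2 +
        (1 + d ^ 2) * (ν.real Set.univ * Real.exp (-d))) := by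
  rw [hE.lintegral_numIsolated_sq hV hm hh, ← hE.lintegral_numIsolated hV hm hh,
    hE.lintegral_numIsolated_of_homogeneous hV hm hh hd]
  refine (add_le_add_right (lintegral_pair_le hh hm hd) _).trans_eq ?_
  rw [← ENNReal.ofReal_add (by positivity) (by positivity)]
  congr 1
  ring

theorem HasIndependentEdges.meanDegree_of_homogeneous (hV : IsPoissonProcess P ν V)
    (hE : HasIndependentEdges P h V G X) (hm : Measurable (Function.uncurry h))
    (hh : IsConnectionFunction h) (hd : ∀ a, ∫ z, h a z ∂ν = d) (hν : ν ≠ 0) :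
    meanDegree P V G = ENNReal.ofReal d := by
  have hnum := hE.lintegral_degreeSum hV hm hh
  simp only [hh.lintegral_ofReal hm, hd, lintegral_const] at hnum
  rw [meanDegree, hE.lintegral_card hV hm hh]
  exact (congrArg (· / ν Set.univ) hnum).trans <|
    ENNReal.mul_div_cancel_right (Measure.measure_univ_ne_zero.2 hν) (measure_ne_top _ _)

end Homogeneous

section MomentMethod

variable {Ω : Type*} [MeasurableSpace Ω] {P : Measure Ω} [IsProbabilityMeasure P] {N : Ω → ℕ}
  {M : ℝ}

theorem one_sub_le_measureReal_eq_zero (hN : Measurable N) (hM : 0 ≤ M)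
    (hmean : ∫⁻ ω, (N ω : ℝ≥0∞) ∂P ≤ ENNReal.ofReal M) : 1 - M ≤ P.real {ω | N ω = 0} := by
  have hA : MeasurableSet {ω | N ω = 0} := hN (measurableSet_singleton 0)
  have hle : P {ω | N ω = 0}ᶜ ≤ ENNReal.ofReal M := by
    rw [← lintegral_indicator_one hA.compl]
    refine (lintegral_mono fun ω => ?_).trans hmean
    by_cases hω : N ω = 0 <;> simp [hω, Nat.one_le_iff_ne_zero]
  have hreal := ENNReal.toReal_le_of_le_ofReal hM hle
  rw [← measureReal_def, probReal_compl_eq_one_sub hA] at hreal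
  linarith

theorem measureReal_eq_zero_le_div_sq {v : ℝ} (hN : Measurable N) (hM : 0 < M)
    (hv : 0 ≤ v) (hmean : ∫⁻ ω, (N ω : ℝ≥0∞) ∂P = ENNReal.ofReal M)
    (hsq : ∫⁻ ω, (N ω : ℝ≥0∞) ^ 2 ∂P ≤ ENNReal.ofReal (M ^ 2 + v)) :
    P.real {ω | N ω = 0} ≤ v / M ^ 2 := by
  have hcast : ∀ ω, ENNReal.ofReal (N ω) = (N ω : ℝ≥0∞) := fun ω => ENNReal.ofReal_natCast _
  have hNr : Measurable fun ω => (N ω : ℝ) := measurable_from_top.comp hN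
  have hsq_ofReal : ∫⁻ ω, ENNReal.ofReal ((N ω : ℝ) ^ 2) ∂P ≤ ENNReal.ofReal (M ^ 2 + v) := by
    simpa only [ENNReal.ofReal_pow (Nat.cast_nonneg _), hcast] using hsq
  have hL2 : MemLp (fun ω => (N ω : ℝ)) 2 P :=
    (memLp_two_iff_integrable_sq hNr.aestronglyMeasurable).2
      ⟨(hNr.pow_const 2).aestronglyMeasurable,
      (hasFiniteIntegral_iff_ofReal (ae_of_all _ fun ω => sq_nonneg _)).2
        (hsq_ofReal.trans_lt ENNReal.ofReal_lt_top)⟩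
  have hmean_real : ∫ ω, (N ω : ℝ) ∂P = M := by
    rw [integral_eq_lintegral_of_nonneg_ae (ae_of_all _ fun ω => Nat.cast_nonneg _)
      hNr.aestronglyMeasurable]
    simp only [hcast, hmean, ENNReal.toReal_ofReal hM.le]
  have hvar : Var[fun ω => (N ω : ℝ); P] ≤ v := by
    rw [variance_eq_sub hL2, hmean_real, sub_le_iff_le_add']
    simp only [Pi.pow_apply]
    rw [integral_eq_lintegral_of_nonneg_ae (ae_of_all _ fun ω => sq_nonneg _)
      (hNr.pow_const 2).aestronglyMeasurable]
    exact ENNReal.toReal_le_of_le_ofReal (by positivity) hsq_ofReal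
  have hsub : {ω | N ω = 0} ⊆ {ω | M ≤ |(N ω : ℝ) - ∫ ω, (N ω : ℝ) ∂P|} := fun ω hω => by
    have hω0 : N ω = 0 := hω
    simp [hmean_real, hω0, le_abs_self]
  refine ENNReal.toReal_le_of_le_ofReal (by positivity) ((measure_mono hsub).trans ?_)
  exact (meas_ge_le_variance_div_sq hL2 hM).trans (ENNReal.ofReal_le_ofReal (by gcongr))

end MomentMethod

section Circle

variable {H : ℝ → ℝ}

/-- The expected degree of a point at connection range `R` on the circle of length `L`: the integral
of `H (|t| / R)` over `[-(L / 2), L / 2]`, folded at `0` and rescaled by `R`. -/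
noncomputable def expectedDegree (H : ℝ → ℝ) (R L : ℝ) : ℝ :=
  2 * R * ∫ r in 0..L / (2 * R), H r

theorem expectedDegree_nonneg (h01 : ∀ r, 0 ≤ r → 0 ≤ H r ∧ H r ≤ 1) {R L : ℝ} (hR : 0 ≤ R)
    (hL : 0 ≤ L) : 0 ≤ expectedDegree H R L :=
  mul_nonneg (by positivity) <| intervalIntegral.integral_nonneg (by positivity) fun r hr =>
    (h01 r hr.1).1

theorem measurable_comp_of_nonneg {α : Type*} [MeasurableSpace α]
    (hH : Measurable fun r : ℝ≥0 => H r) {f : α → ℝ} (hf : Measurable f) (h0 : ∀ x, 0 ≤ f x) :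
    Measurable fun x => H (f x) :=
  hH.comp (hf.subtype_mk (h := h0))

theorem isConnectionFunction_scaledConnection (h01 : ∀ r, 0 ≤ r → 0 ≤ H r ∧ H r ≤ 1) {R : ℝ}
    (hR : 0 ≤ R) (L : ℝ) : IsConnectionFunction (scaledConnection H R L) where
  symm x y := by rw [scaledConnection, scaledConnection, norm_sub_rev]
  nonneg x y := (h01 _ (by positivity)).1
  le_one x y := (h01 _ (by positivity)).2

theorem measurable_scaledConnection (hH : Measurable fun r : ℝ≥0 => H r) {R : ℝ} (hR : 0 ≤ R)
    (L : ℝ) : Measurable (Function.uncurry (scaledConnection H R L)) :=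
  measurable_comp_of_nonneg hH (f := fun p : AddCircle L × AddCircle L => ‖p.1 - p.2‖ / R)
    (by fun_prop) (fun p => by positivity)

theorem integral_comp_abs_div_zero_right (H : ℝ → ℝ) {R a : ℝ} (hR : R ≠ 0) (ha : 0 ≤ a) :
    ∫ t in 0..a, H (|t| / R) = R * ∫ r in 0..a / R, H r := by
  have habs : ∫ t in 0..a, H (|t| / R) = ∫ t in 0..a, H (t / R) := by
    refine intervalIntegral.integral_congr fun t ht => ?_
    rw [Set.uIcc_of_le ha] at ht
    simp only [abs_of_nonneg ht.1]
  rw [habs, intervalIntegral.integral_comp_div _ hR, zero_div, smul_eq_mul]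

theorem integral_comp_abs_neg_zero (f : ℝ → ℝ) (a : ℝ) :
    ∫ t in -a..0, f |t| = ∫ t in 0..a, f |t| := by
  simpa only [abs_neg, neg_zero] using
    (intervalIntegral.integral_comp_neg (a := 0) (b := a) fun t => f |t|).symm

theorem intervalIntegrable_comp_abs_div (hH : Measurable fun r : ℝ≥0 => H r)
    (h01 : ∀ r, 0 ≤ r → 0 ≤ H r ∧ H r ≤ 1) {R : ℝ} (hR : 0 ≤ R) (s t : ℝ) :
    IntervalIntegrable (fun a : ℝ => H (|a| / R)) volume s t := by
  have hm : Measurable fun a : ℝ => H (|a| / R) :=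
    measurable_comp_of_nonneg hH (by fun_prop) fun a => by positivity
  refine (intervalIntegrable_const (c := (1 : ℝ))).mono_fun hm.aestronglyMeasurable
    (ae_of_all _ fun a => ?_)
  obtain ⟨h0, h1⟩ := h01 (|a| / R) (by positivity)
  beta_reduce
  rwa [Real.norm_of_nonneg h0, norm_one]

theorem integral_scaledConnection_zero (hH : Measurable fun r : ℝ≥0 => H r)
    (h01 : ∀ r, 0 ≤ r → 0 ≤ H r ∧ H r ≤ 1) {R : ℝ} (hR : 0 < R) (L : ℝ) [hL : Fact (0 < L)] :
    ∫ z : AddCircle L, scaledConnection H R L 0 z = expectedDegree H R L := by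
  have hL0 := hL.out
  have hnorm : ∫ a in -(L / 2)..L / 2, scaledConnection H R L 0 (a : AddCircle L) =
      ∫ a in -(L / 2)..L / 2, H (|a| / R) := by
    refine intervalIntegral.integral_congr fun a ha => ?_
    rw [Set.uIcc_of_le (by linarith)] at ha
    have ha' : |a| ≤ |L| / 2 := by rw [abs_of_pos hL0]; exact abs_le.2 ha
    simp only [scaledConnection, zero_sub, norm_neg,
      (AddCircle.norm_coe_eq_abs_iff L hL0.ne').2 ha']
  have hint := intervalIntegrable_comp_abs_div hH h01 hR.le
  rw [← AddCircle.intervalIntegral_preimage L (-(L / 2)), neg_add_eq_sub, sub_half, hnorm,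
    ← intervalIntegral.integral_add_adjacent_intervals (hint _ 0) (hint 0 _),
    integral_comp_abs_neg_zero (fun t => H (t / R)),
    integral_comp_abs_div_zero_right H hR.ne' (by positivity), div_div, expectedDegree]
  ring

theorem integral_scaledConnection (hH : Measurable fun r : ℝ≥0 => H r)
    (h01 : ∀ r, 0 ≤ r → 0 ≤ H r ∧ H r ≤ 1) {R : ℝ} (hR : 0 < R) (L : ℝ) [Fact (0 < L)]
    (x : AddCircle L) : ∫ z, scaledConnection H R L x z = expectedDegree H R L := by
  have htrans : ∀ z, scaledConnection H R L x z = scaledConnection H R L 0 (x - z) := fun z => by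
    rw [scaledConnection, scaledConnection, zero_sub, norm_neg]
  simp only [htrans]
  rw [integral_sub_left_eq_self (scaledConnection H R L 0) volume x,
    integral_scaledConnection_zero hH h01 hR L]

theorem volume_real_univ_addCircle (L : ℝ) [hL : Fact (0 < L)] :
    (volume : Measure (AddCircle L)).real Set.univ = L := by
  rw [measureReal_def, AddCircle.measure_univ, ENNReal.toReal_ofReal hL.out.le]

variable {Ω : Type*} [MeasurableSpace Ω] {P : Measure Ω} {R L : ℝ} [Fact (0 < L)]
  {V : Ω → Finset (AddCircle L)} {G : Ω → SimpleGraph (AddCircle L)}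

theorem IsSoftRGG.meanDegree_eq (hG : IsSoftRGG P L (scaledConnection H R L) V G)
    (hH : Measurable fun r : ℝ≥0 => H r) (h01 : ∀ r, 0 ≤ r → 0 ≤ H r ∧ H r ≤ 1) (hR : 0 < R) :
    meanDegree P V G = ENNReal.ofReal (expectedDegree H R L) := by
  obtain ⟨hV, X, hE⟩ := hG
  exact hE.meanDegree_of_homogeneous hV (measurable_scaledConnection hH hR.le L)
    (isConnectionFunction_scaledConnection h01 hR.le L) (integral_scaledConnection hH h01 hR L)
    NeZero.out

variable [IsProbabilityMeasure P]

theorem IsSoftRGG.one_sub_le_measureReal_numIsolated_eq_zero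
    (hG : IsSoftRGG P L (scaledConnection H R L) V G)
    (hH : Measurable fun r : ℝ≥0 => H r) (h01 : ∀ r, 0 ≤ r → 0 ≤ H r ∧ H r ≤ 1) (hR : 0 < R) :
    1 - L * Real.exp (-expectedDegree H R L) ≤ P.real {ω | numIsolated (V ω) (G ω) = 0} := by
  obtain ⟨hV, X, hE⟩ := hG
  have hmean := hE.lintegral_numIsolated_of_homogeneous hV (measurable_scaledConnection hH hR.le L)
    (isConnectionFunction_scaledConnection h01 hR.le L) (integral_scaledConnection hH h01 hR L)
  rw [volume_real_univ_addCircle] at hmean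
  exact one_sub_le_measureReal_eq_zero hE.measurable_numIsolated
    (mul_nonneg (Fact.out : 0 < L).le (Real.exp_nonneg _)) hmean.le

theorem IsSoftRGG.measureReal_numIsolated_eq_zero_le
    (hG : IsSoftRGG P L (scaledConnection H R L) V G)
    (hH : Measurable fun r : ℝ≥0 => H r) (h01 : ∀ r, 0 ≤ r → 0 ≤ H r ∧ H r ≤ 1) (hR : 0 < R) :
    P.real {ω | numIsolated (V ω) (G ω) = 0} ≤
      (1 + expectedDegree H R L ^ 2) * (Real.exp (expectedDegree H R L) / L) := by
  obtain ⟨hV, X, hE⟩ := hG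
  have hL : 0 < L := Fact.out
  have hm := measurable_scaledConnection hH hR.le L
  have hh := isConnectionFunction_scaledConnection h01 hR.le L
  have hd := integral_scaledConnection hH h01 hR L
  have hmean := hE.lintegral_numIsolated_of_homogeneous hV hm hh hd
  have hsq := hE.lintegral_numIsolated_sq_le hV hm hh hd
  rw [volume_real_univ_addCircle] at hmean hsq
  refine (measureReal_eq_zero_le_div_sq hE.measurable_numIsolated (by positivity) (by positivity)
    hmean hsq).trans_eq ?_
  rw [Real.exp_neg]
  field_simp

end Circle

section Asymptotics

theorem tendsto_div_log_atTop : Tendsto (fun L : ℝ => L / Real.log L) atTop atTop := by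
  refine ((Real.tendsto_exp_div_pow_atTop 1).comp Real.tendsto_log_atTop).congr' ?_
  filter_upwards [eventually_gt_atTop 0] with L hL
  simp [Real.exp_log hL]

theorem tendsto_expectedDegree_div_log {H : ℝ → ℝ} (hH : IntegrableOn H (Set.Ioi 0)) {γ : ℝ}
    (hγ : 0 < γ) :
    Tendsto (fun L => expectedDegree H (γ * Real.log L) L / Real.log L) atTop
      (𝓝 (2 * γ * ∫ r in Set.Ioi 0, H r)) := by
  have hupper : Tendsto (fun L : ℝ => L / (2 * (γ * Real.log L))) atTop atTop := by
    refine (tendsto_div_log_atTop.const_mul_atTop (inv_pos.2 (mul_pos two_pos hγ))).congr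
      fun L => ?_
    rw [inv_mul_eq_div, div_div, mul_comm (Real.log L), mul_assoc]
  refine ((intervalIntegral_tendsto_integral_Ioi 0 hH hupper).const_mul (2 * γ)).congr' ?_
  filter_upwards [eventually_gt_atTop 1] with L hL
  have := Real.log_pos hL
  rw [expectedDegree]
  field_simp

variable {d : ℝ → ℝ} {κ : ℝ}

theorem tendsto_one_add_sq_mul_exp_div (hd : Tendsto (fun L => d L / Real.log L) atTop (𝓝 κ))
    (hκ : κ < 1) : Tendsto (fun L => (1 + d L ^ 2) * (Real.exp (d L) / L)) atTop (𝓝 0) := by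
  obtain ⟨c, hκc, hc1⟩ := exists_between hκ
  have hb : 0 < 1 - c := sub_pos.2 hc1
  have hlog : Tendsto (fun L : ℝ => Real.log L ^ (2 : ℝ) / L ^ (1 - c)) atTop (𝓝 0) :=
    (isLittleO_log_rpow_rpow_atTop 2 hb).tendsto_div_nhds_zero
  have hbound := (tendsto_rpow_neg_atTop hb).add ((hd.pow 2).mul hlog)
  rw [mul_zero, add_zero] at hbound
  refine squeeze_zero' ?_ ?_ hbound
  · filter_upwards [eventually_gt_atTop 0] with L hL
    positivity
  filter_upwards [eventually_gt_atTop 1, hd.eventually_lt_const hκc] with L hL hdL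
  have hL0 : 0 < L := by linarith
  have hlogL : 0 < Real.log L := Real.log_pos hL
  have hexp : Real.exp (d L) / L ≤ L ^ (-(1 - c)) := by
    rw [neg_sub, Real.rpow_sub_one hL0.ne', Real.rpow_def_of_pos hL0, mul_comm _ c]
    gcongr
    exact ((div_lt_iff₀ hlogL).1 hdL).le
  calc (1 + d L ^ 2) * (Real.exp (d L) / L) ≤ (1 + d L ^ 2) * L ^ (-(1 - c)) := by gcongr
    _ = _ := by
      rw [Real.rpow_neg hL0.le, Real.rpow_two]
      field_simp

theorem tendsto_mul_exp_neg (hd : Tendsto (fun L => d L / Real.log L) atTop (𝓝 κ))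
    (hκ : 1 < κ) : Tendsto (fun L => L * Real.exp (-d L)) atTop (𝓝 0) := by
  obtain ⟨c, hc1, hcκ⟩ := exists_between hκ
  refine squeeze_zero' ?_ ?_ (tendsto_rpow_neg_atTop (sub_pos.2 hc1))
  · filter_upwards [eventually_ge_atTop 0] with L hL
    positivity
  filter_upwards [eventually_gt_atTop 1, hd.eventually_const_lt hcκ] with L hL hdL
  have hL0 : 0 < L := by linarith
  rw [neg_sub, sub_eq_add_neg, Real.rpow_add hL0, Real.rpow_one, Real.rpow_def_of_pos hL0,
    mul_neg, mul_comm _ c]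
  gcongr
  exact ((lt_div_iff₀ (Real.log_pos hL)).1 hdL).le

end Asymptotics

theorem mainTheorem1
    (H : ℝ → ℝ)
    (hH_meas : Measurable fun r : ℝ≥0 => H r)
    (hH_range : ∀ r : ℝ, 0 ≤ r → 0 ≤ H r ∧ H r ≤ 1)
    (hH_int : IntegrableOn H (Set.Ioi 0))
    (γ : ℝ) (hγ : 0 < γ)
    {Ω : ℝ → Type*} [∀ L, MeasurableSpace (Ω L)]
    (P : ∀ L, Measure (Ω L)) [∀ L, IsProbabilityMeasure (P L)]
    (V : ∀ L, Ω L → Finset (AddCircle L))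
    (G : ∀ L, Ω L → SimpleGraph (AddCircle L))
    (hG : ∀ (L : ℝ) [Fact (0 < L)], 1 < L →
      IsSoftRGG (P L) L (scaledConnection H (γ * Real.log L) L) (V L) (G L)) :
    (2 * γ * (∫ r in Set.Ioi 0, H r) < 1 →
      Tendsto (fun L => (P L).real {ω | numIsolated (V L ω) (G L ω) = 0}) atTop (𝓝 0)) ∧
    (1 < 2 * γ * (∫ r in Set.Ioi 0, H r) →
      Tendsto (fun L => (P L).real {ω | numIsolated (V L ω) (G L ω) = 0}) atTop (𝓝 1)) ∧
    (∀ (L : ℝ) [Fact (0 < L)], 1 < L →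
      meanDegree (P L) (V L) (G L) =
        ENNReal.ofReal (∫ z : AddCircle L, scaledConnection H (γ * Real.log L) L 0 z)) ∧
    Tendsto (fun L => (meanDegree (P L) (V L) (G L)).toReal / Real.log L) atTop
      (𝓝 (2 * γ * ∫ r in Set.Ioi 0, H r)) := by
  have hd := tendsto_expectedDegree_div_log hH_int hγ
  have hR : ∀ L : ℝ, 1 < L → 0 < γ * Real.log L := fun L hL => mul_pos hγ (Real.log_pos hL)
  refine ⟨fun hlt => ?_, fun hgt => ?_, fun L _ hL => ?_, hd.congr' ?_⟩
  · refine squeeze_zero' (.of_forall fun L => measureReal_nonneg) ?_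
      (tendsto_one_add_sq_mul_exp_div hd hlt)
    filter_upwards [eventually_gt_atTop 1] with L hL
    have : Fact (0 < L) := ⟨zero_lt_one.trans hL⟩
    exact (hG L hL).measureReal_numIsolated_eq_zero_le hH_meas hH_range (hR L hL)
  · refine tendsto_of_tendsto_of_tendsto_of_le_of_le'
      (by simpa using (tendsto_mul_exp_neg hd hgt).const_sub 1) tendsto_const_nhds ?_
      (.of_forall fun L => measureReal_le_one)
    filter_upwards [eventually_gt_atTop 1] with L hL
    have : Fact (0 < L) := ⟨zero_lt_one.trans hL⟩
    exact (hG L hL).one_sub_le_measureReal_numIsolated_eq_zero hH_meas hH_range (hR L hL)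
  · rw [(hG L hL).meanDegree_eq hH_meas hH_range (hR L hL),
      integral_scaledConnection hH_meas hH_range (hR L hL)]
  · filter_upwards [eventually_gt_atTop 1] with L hL
    have : Fact (0 < L) := ⟨zero_lt_one.trans hL⟩
    rw [(hG L hL).meanDegree_eq hH_meas hH_range (hR L hL), ENNReal.toReal_ofReal]
    exact expectedDegree_nonneg hH_range (hR L hL).le this.out.le
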